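/- Let $k\ge 1$ be an integer and $\sigma>0$. There is a constant $C>0$, depending only on $k$ and $\sigma$ (in particular not on the mesh size), such that the following holds. Let $\Omega\subset\mathbb{R}^2$ be a polygonal domain and let $\mathcal{T}_h$ be a finite conforming partition of $\overline\Omega$ into closed triangles (two different triangles are disjoint or share exactly a vertex or a whole edge) that is shape regular with parameter $\sigma$: every $T\in\mathcal{T}_h$, with diameter $h_T$, contains a disk of diameter at least $h_T/\sigma$. Let $\mathcal{E}_h$ be the set of all edges and let $V_h$ be the space of weak functions $v=\{v_0,v_b\}$, where $v_0|_T\in P_k(T)$ for every $T\in\mathcal{T}_h$ and $v_b|_e\in P_{k+1}(e)$ for every $e\in\mathcal{E}_h$, with a single $v_b$ on each edge. (Here $P_m$ denotes polynomials of total degree at most $m$.) For $v\in V_h$ the weak gradient $\nabla_w v$ is the piecewise polynomial vector field with $\nabla_w v|_T\in[P_{k+1}(T)]^2$ determined on each $T\in\mathcal{T}_h$ by $$\int_T \nabla_w v\cdot \mathbf q\,d\mathbf{x}=-\int_T v_0\,\nabla\cdot\mathbf q\,d\mathbf{x}+\int_{\partial T}v_b\,\mathbf q\cdot\mathbf n\,ds\qquad\text{for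 all }\mathbf q\in[P_{k+1}(T)]^2,$$ where $\mathbf n$ is the outward unit normal to $\partial T$. Then, for every $v\in V_h$, $$\sum_{T\in\mathcal{T}_h}h_T^{-1}\int_{\partial T}|v_0|_T-v_b|^2\,ds\;\le\; C\,|||v|||^2,\qquad |||v|||^2=\sum_{T\in\mathcal{T}_h}\int_T|\nabla_w v|^2\,d\mathbf{x}.$$ -/

import Mathlib

open MeasureTheory
open scoped RealInnerProductSpace

noncomputable section

namespace WG

/-- The plane `ℝ²` with its Euclidean norm. -/
abbrev Plane : Type := EuclideanSpace ℝ (Fin 2)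

/-! ### Polynomials on subsets of the plane -/

/-- The value at `x` of a polynomial in the two coordinates. -/
def polyEval (p : MvPolynomial (Fin 2) ℝ) (x : Plane) : ℝ :=
  MvPolynomial.eval (fun i => x i) p

/-- `f|_S ∈ P_m(S)`: on `S` the function `f` is a polynomial of total degree at most `m`.
If `S` is a line segment, these are the polynomials of degree at most `m` in the arc length
of the segment. -/
def IsPolyOn (m : ℕ) (S : Set Plane) (f : Plane → ℝ) : Prop :=
  ∃ p : MvPolynomial (Fin 2) ℝ, p.totalDegree ≤ m ∧ ∀ x ∈ S, f x = polyEval p x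

/-- Vector fields in `[P_m]²`. -/
abbrev PolyField (m : ℕ) : Type :=
  Fin 2 → MvPolynomial.restrictTotalDegree (Fin 2) ℝ m

/-- The value of a polynomial vector field at a point. -/
def PolyField.val {m : ℕ} (q : PolyField m) (x : Plane) : Plane :=
  !₂[polyEval (q 0) x, polyEval (q 1) x]

/-- The divergence of a polynomial vector field at a point. -/
def PolyField.div {m : ℕ} (q : PolyField m) (x : Plane) : ℝ :=
  polyEval (MvPolynomial.pderiv 0 (q 0 : MvPolynomial (Fin 2) ℝ)
    + MvPolynomial.pderiv 1 (q 1 : MvPolynomial (Fin 2) ℝ)) x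

/-! ### Triangles

A triangle or an edge is given by the finite set of its vertices; the closed triangle or the
closed edge itself is the convex hull of that set. The edge of the triangle `T` opposite to its
vertex `a` is `T.erase a`. -/

/-- The closed triangle, or the closed edge, with the given vertices. -/
def hull (s : Finset Plane) : Set Plane := convexHull ℝ (s : Set Plane)

/-- The diameter `h_T`. -/
def diam (T : Finset Plane) : ℝ := Metric.diam (hull T)

/-- The integral over an edge with respect to arc length. -/
def edgeIntegral (e : Finset Plane) (f : Plane → ℝ) : ℝ :=
  ∫ x in hull e, f x ∂(Measure.hausdorffMeasure 1 : Measure Plane)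

/-- The unit normal to the edge `T.erase a` of the triangle `T` that points out of `T`, that is,
away from the opposite vertex `a`: the normalized component orthogonal to the edge of
the vectors from `a` to the points of the edge. -/
def outwardNormal (T : Finset Plane) (a : Plane) : Plane :=
  NormedSpace.normalize
    ((vectorSpan ℝ ((T.erase a : Finset Plane) : Set Plane))ᗮ.starProjection
      (∑ x ∈ T.erase a, (x - a)))

/-! ### Meshes -/

/-- A partition of `Ω` into triangles: a finite simplicial complex in the plane that fills
the closure of `Ω`. -/
structure Mesh (Ω : Set Plane) where
  /-- the complex of all triangles, edges and vertices -/
  complex : Geometry.SimplicialComplex ℝ Plane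
  finite : complex.faces.Finite
  space_eq : complex.space = closure Ω

namespace Mesh

variable {Ω : Set Plane}

/-- The set `𝓣_h` of all triangles of the mesh. -/
def triangles (K : Mesh Ω) : Finset (Finset Plane) :=
  K.finite.toFinset.filter fun s => s.card = 3

/-- The set `𝓔_h` of all edges of the mesh. -/
def edges (K : Mesh Ω) : Finset (Finset Plane) :=
  K.finite.toFinset.filter fun s => s.card = 2

/-- Shape regularity with parameter `σ`: every triangle `T` contains a disk of
diameter at least `h_T / σ`. -/
def ShapeRegular (K : Mesh Ω) (σ : ℝ) : Prop :=
  ∀ T ∈ K.triangles, ∃ (c : Plane) (r : ℝ),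
    0 < r ∧ Metric.closedBall c r ⊆ hull T ∧ diam T ≤ σ * (2 * r)

end Mesh

/-! ### Weak functions and their weak gradients -/

/-- The space `V_h` of weak functions `v = {v₀, v_b}`: a polynomial `v0 T` of degree at most `k`
on each triangle `T`, and a polynomial `vb e` of degree at most `k + 1` on each edge `e`, the same
one for both triangles that share `e`. (Only the values of `v0 T` on `T` and of `vb e` on `e`
matter.) -/
structure WeakFunction {Ω : Set Plane} (K : Mesh Ω) (k : ℕ) where
  v0 : Finset Plane → Plane → ℝ
  vb : Finset Plane → Plane → ℝ
  v0_poly : ∀ T ∈ K.triangles, IsPolyOn k (hull T) (v0 T)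
  vb_poly : ∀ e ∈ K.edges, IsPolyOn (k + 1) (hull e) (vb e)

/-- `g ∈ [P_m(T)]²` is the weak gradient on `T` of the weak function with interior part `f`
and boundary part `fb`: for all `q ∈ [P_m(T)]²`,
`(g, q)_T = -(f, ∇ ⬝ q)_T + ⟨fb, q ⬝ n⟩_∂T`. -/
def IsWeakGradient {m : ℕ} (T : Finset Plane) (f : Plane → ℝ) (fb : Finset Plane → Plane → ℝ)
    (g : PolyField m) : Prop :=
  ∀ q : PolyField m,
    ∫ x in hull T, ⟪g.val x, q.val x⟫ =
      -(∫ x in hull T, f x * q.div x)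
        + ∑ a ∈ T, edgeIntegral (T.erase a)
            (fun x => fb (T.erase a) x * ⟪q.val x, outwardNormal T a⟫)

/-- The weak gradient `∇_w v|_T ∈ [P_{k+1}(T)]²` of `v ∈ V_h` on the triangle `T`. It is
well defined by `WeakFunction.existsUnique_weakGradient` below. -/
def WeakFunction.weakGradient {Ω : Set Plane} {K : Mesh Ω} {k : ℕ} (v : WeakFunction K k)
    (T : Finset Plane) : PolyField (k + 1) :=
  Classical.epsilon (IsWeakGradient T (v.v0 T) v.vb)

/-- The squared semi-norm `|||v|||² = ∑_T ‖∇_w v‖²_T`. -/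
def WeakFunction.tripleNormSq {Ω : Set Plane} {K : Mesh Ω} {k : ℕ} (v : WeakFunction K k) : ℝ :=
  ∑ T ∈ K.triangles, ∫ x in hull T, ‖(v.weakGradient T).val x‖ ^ 2

/-- `‖v₀ - v_b‖²_∂T`. -/
def WeakFunction.jumpSq {Ω : Set Plane} {K : Mesh Ω} {k : ℕ} (v : WeakFunction K k)
    (T : Finset Plane) : ℝ :=
  ∑ a ∈ T, edgeIntegral (T.erase a) (fun x => (v.v0 T x - v.vb (T.erase a) x) ^ 2)

/-! ### The weak gradient is well defined -/

theorem continuous_polyEval (p : MvPolynomial (Fin 2) ℝ) : Continuous (polyEval p) := by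
  unfold polyEval
  exact (MvPolynomial.continuous_eval p).comp (by fun_prop)

theorem PolyField.continuous_val {m : ℕ} (q : PolyField m) : Continuous q.val := by
  unfold PolyField.val
  have h0 := continuous_polyEval (q 0 : MvPolynomial (Fin 2) ℝ)
  have h1 := continuous_polyEval (q 1 : MvPolynomial (Fin 2) ℝ)
  refine (PiLp.continuous_toLp 2 _).comp (continuous_pi fun i => ?_)
  fin_cases i
  · exact h0
  · exact h1

theorem PolyField.continuous_div {m : ℕ} (q : PolyField m) : Continuous q.div :=
  continuous_polyEval _

theorem PolyField.val_add {m : ℕ} (q r : PolyField m) (x : Plane) :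
    (q + r).val x = q.val x + r.val x := by
  ext i
  fin_cases i <;> simp [PolyField.val, polyEval]

theorem PolyField.val_smul {m : ℕ} (c : ℝ) (q : PolyField m) (x : Plane) :
    (c • q).val x = c • q.val x := by
  ext i
  fin_cases i <;> simp [PolyField.val, polyEval]

theorem PolyField.div_add {m : ℕ} (q r : PolyField m) (x : Plane) :
    (q + r).div x = q.div x + r.div x := by
  simp [PolyField.div, polyEval]; ring

theorem PolyField.div_smul {m : ℕ} (c : ℝ) (q : PolyField m) (x : Plane) :
    (c • q).div x = c * q.div x := by
  simp [PolyField.div, polyEval]; ring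

theorem isCompact_hull (s : Finset Plane) : IsCompact (hull s) :=
  s.finite_toSet.isCompact_convexHull ℝ

theorem hausdorff_hull_lt_top {e : Finset Plane} (he : e.card = 2) :
    (Measure.hausdorffMeasure 1 : Measure Plane) (hull e) < ⊤ := by
  obtain ⟨x, y, -, rfl⟩ := Finset.card_eq_two.mp he
  have : hull {x, y} = segment ℝ x y := by simp [hull]
  rw [this, hausdorffMeasure_segment]
  exact edist_lt_top x y

theorem IsPolyOn.integrableOn_mul {m : ℕ} {s : Finset Plane} {f g : Plane → ℝ}
    (hf : IsPolyOn m (hull s) f) (hg : Continuous g) (μ : Measure Plane) (hμ : μ (hull s) < ⊤) :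
    IntegrableOn (fun x => f x * g x) (hull s) μ := by
  obtain ⟨p, -, hp⟩ := hf
  have hc : Continuous fun x => polyEval p x * g x := (continuous_polyEval p).mul hg
  have h1 : IntegrableOn (fun x => polyEval p x * g x) (hull s) μ := by
    obtain ⟨C, hC⟩ := (isCompact_hull s).exists_bound_of_continuousOn hc.continuousOn
    exact Measure.integrableOn_of_bounded hμ.ne hc.aestronglyMeasurable
      ((ae_restrict_iff' (isCompact_hull s).measurableSet).mpr (ae_of_all _ hC))
  refine h1.congr_fun (fun x hx => ?_) (isCompact_hull s).measurableSet
  simp only [hp x hx]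

theorem interior_hull_nonempty {T : Finset Plane} (hc : T.card = 3)
    (hi : AffineIndependent ℝ ((↑) : T → Plane)) : (interior (hull T)).Nonempty := by
  have hspan : affineSpan ℝ (T : Set Plane) = ⊤ := by
    have := hi.affineSpan_eq_top_iff_card_eq_finrank_add_one.mpr (by simp [hc])
    simpa using this
  exact interior_convexHull_nonempty_iff_affineSpan_eq_top.mpr hspan

theorem polyEval_eq_zero {p : MvPolynomial (Fin 2) ℝ} {U : Set Plane} (hU : IsOpen U)
    (hne : U.Nonempty) (h : ∀ x ∈ U, polyEval p x = 0) : p = 0 := by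
  obtain ⟨c, hcU⟩ := hne
  have hV : IsOpen ((WithLp.toLp 2 : (Fin 2 → ℝ) → Plane) ⁻¹' U) :=
    hU.preimage (PiLp.continuous_toLp 2 _)
  obtain ⟨ε, hε, hball⟩ := Metric.isOpen_iff.mp hV (fun i => c i) hcU
  refine MvPolynomial.funext_set (fun i => Metric.ball (c i) ε) (fun i => ?_) fun x hx => ?_
  · rw [Real.ball_eq_Ioo]
    exact Set.Ioo_infinite (by linarith)
  · rw [map_zero]
    rw [ball_pi _ hε |>.symm] at hx
    exact h (WithLp.toLp 2 x) (hball hx)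

theorem PolyField.eq_zero_of_integral {m : ℕ} {T : Finset Plane} (hc : T.card = 3)
    (hi : AffineIndependent ℝ ((↑) : T → Plane)) {g : PolyField m}
    (hg : ∫ x in hull T, ⟪g.val x, g.val x⟫ = 0) : g = 0 := by
  have hcont : Continuous fun x => ⟪g.val x, g.val x⟫ := g.continuous_val.inner g.continuous_val
  have hint : IntegrableOn (fun x => ⟪g.val x, g.val x⟫) (hull T) volume :=
    hcont.continuousOn.integrableOn_compact (isCompact_hull T)
  rw [setIntegral_eq_zero_iff_of_nonneg_ae
    (Filter.Eventually.of_forall fun x => real_inner_self_nonneg) hint] at hg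
  have hae : (fun x => ⟪g.val x, g.val x⟫) =ᵐ[volume.restrict (interior (hull T))]
      fun _ => (0 : ℝ) := ae_restrict_of_ae_restrict_of_subset interior_subset hg
  have heq := Measure.eqOn_open_of_ae_eq hae isOpen_interior hcont.continuousOn continuousOn_const
  have hval : ∀ x ∈ interior (hull T), g.val x = 0 := fun x hx => by
    have := heq hx
    simpa using this
  have hne := interior_hull_nonempty hc hi
  funext i
  apply Subtype.ext
  refine polyEval_eq_zero isOpen_interior hne fun x hx => ?_
  have h := congrArg (fun y : Plane => y i) (hval x hx)
  fin_cases i <;> simpa [PolyField.val] using h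

/-- The `L²(T)` inner product on polynomial vector fields. -/
def innerForm (m : ℕ) (T : Finset Plane) : PolyField m →ₗ[ℝ] PolyField m →ₗ[ℝ] ℝ :=
  have hint : ∀ g q : PolyField m, IntegrableOn (fun x => ⟪g.val x, q.val x⟫) (hull T) volume :=
    fun g q => (g.continuous_val.inner q.continuous_val).continuousOn.integrableOn_compact
      (isCompact_hull T)
  LinearMap.mk₂ ℝ (fun g q => ∫ x in hull T, ⟪g.val x, q.val x⟫)
    (fun g g' q => by
      simp only [PolyField.val_add, inner_add_left]
      exact integral_add (hint g q) (hint g' q))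
    (fun c g q => by
      simp only [PolyField.val_smul, real_inner_smul_left]
      exact integral_const_mul _ _)
    (fun g q q' => by
      simp only [PolyField.val_add, inner_add_right]
      exact integral_add (hint g q) (hint g q'))
    (fun c g q => by
      simp only [PolyField.val_smul, real_inner_smul_right]
      exact integral_const_mul _ _)

theorem Mesh.mem_triangles {Ω : Set Plane} {K : Mesh Ω} {T : Finset Plane} :
    T ∈ K.triangles ↔ T ∈ K.complex.faces ∧ T.card = 3 := by
  simp [Mesh.triangles]

theorem Mesh.erase_mem_edges {Ω : Set Plane} {K : Mesh Ω} {T : Finset Plane}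
    (hT : T ∈ K.triangles) {a : Plane} (ha : a ∈ T) : T.erase a ∈ K.edges := by
  obtain ⟨hf, hc⟩ := Mesh.mem_triangles.mp hT
  have hc2 : (T.erase a).card = 2 := by rw [Finset.card_erase_of_mem ha, hc]
  simp only [Mesh.edges, Finset.mem_filter, Set.Finite.mem_toFinset]
  exact ⟨K.complex.down_closed hf (Finset.erase_subset _ _)
    (Finset.card_pos.mp (by omega)), hc2⟩

theorem WeakFunction.existsUnique_weakGradient {Ω : Set Plane} {K : Mesh Ω} {k : ℕ}
    (v : WeakFunction K k) {T : Finset Plane} (hT : T ∈ K.triangles) :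
    ∃! g : PolyField (k + 1), IsWeakGradient T (v.v0 T) v.vb g := by
  obtain ⟨hf, hc⟩ := Mesh.mem_triangles.mp hT
  have hi := K.complex.indep hf
  have hinj : Function.Injective (innerForm (k + 1) T) := by
    rw [injective_iff_map_eq_zero]
    intro g hg
    exact PolyField.eq_zero_of_integral hc hi (LinearMap.congr_fun hg g)
  have hsurj : Function.Surjective (innerForm (k + 1) T) :=
    (LinearMap.injective_iff_surjective_of_finrank_eq_finrank
      (Subspace.dual_finrank_eq (K := ℝ) (V := PolyField (k + 1))).symm).mp hinj
  have i0 : ∀ q : PolyField (k + 1),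
      IntegrableOn (fun x => v.v0 T x * q.div x) (hull T) volume := fun q =>
    (v.v0_poly T hT).integrableOn_mul q.continuous_div _ (isCompact_hull T).measure_lt_top
  have ib : ∀ a ∈ T, ∀ q : PolyField (k + 1),
      IntegrableOn (fun x => v.vb (T.erase a) x * ⟪q.val x, outwardNormal T a⟫)
        (hull (T.erase a)) (Measure.hausdorffMeasure 1) := fun a ha q =>
    (v.vb_poly _ (Mesh.erase_mem_edges hT ha)).integrableOn_mul
      (q.continuous_val.inner continuous_const) _
      (hausdorff_hull_lt_top (by rw [Finset.card_erase_of_mem ha, hc]))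
  let ℓ : PolyField (k + 1) →ₗ[ℝ] ℝ :=
    { toFun := fun q => -(∫ x in hull T, v.v0 T x * q.div x)
        + ∑ a ∈ T, edgeIntegral (T.erase a)
            (fun x => v.vb (T.erase a) x * ⟪q.val x, outwardNormal T a⟫)
      map_add' := fun q r => by
        have h1 : ∫ x in hull T, v.v0 T x * (q + r).div x =
            (∫ x in hull T, v.v0 T x * q.div x) + ∫ x in hull T, v.v0 T x * r.div x := by
          simp only [PolyField.div_add, mul_add]
          exact integral_add (i0 q) (i0 r)
        have h2 : ∀ a ∈ T, edgeIntegral (T.erase a)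
            (fun x => v.vb (T.erase a) x * ⟪(q + r).val x, outwardNormal T a⟫) =
            edgeIntegral (T.erase a)
              (fun x => v.vb (T.erase a) x * ⟪q.val x, outwardNormal T a⟫) +
            edgeIntegral (T.erase a)
              (fun x => v.vb (T.erase a) x * ⟪r.val x, outwardNormal T a⟫) := fun a ha => by
          simp only [PolyField.val_add, inner_add_left, mul_add]
          exact integral_add (ib a ha q) (ib a ha r)
        rw [h1, Finset.sum_congr rfl h2, Finset.sum_add_distrib]
        ring
      map_smul' := fun c q => by
        have h1 : ∫ x in hull T, v.v0 T x * (c • q).div x =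
            c * ∫ x in hull T, v.v0 T x * q.div x := by
          simp only [PolyField.div_smul, mul_left_comm _ c]
          exact integral_const_mul _ _
        have h2 : ∀ a ∈ T, edgeIntegral (T.erase a)
            (fun x => v.vb (T.erase a) x * ⟪(c • q).val x, outwardNormal T a⟫) =
            c * edgeIntegral (T.erase a)
              (fun x => v.vb (T.erase a) x * ⟪q.val x, outwardNormal T a⟫) := fun a ha => by
          simp only [PolyField.val_smul, real_inner_smul_left, mul_left_comm _ c]
          exact integral_const_mul _ _
        rw [h1, Finset.sum_congr rfl h2, ← Finset.mul_sum]
        simp only [RingHom.id_apply, smul_eq_mul]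
        ring }
  obtain ⟨g, hg⟩ := hsurj ℓ
  refine ⟨g, fun q => LinearMap.congr_fun hg q, fun g' hg' => hinj ?_⟩
  rw [hg]
  exact LinearMap.ext hg'

/-- The defining property of the weak gradient. -/
theorem WeakFunction.isWeakGradient_weakGradient {Ω : Set Plane} {K : Mesh Ω} {k : ℕ}
    (v : WeakFunction K k) {T : Finset Plane} (hT : T ∈ K.triangles) :
    IsWeakGradient T (v.v0 T) v.vb (v.weakGradient T) :=
  Classical.epsilon_spec (v.existsUnique_weakGradient hT).exists

end WG

end

open MeasureTheory
open scoped RealInnerProductSpace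

noncomputable section

namespace WG

/-! ### Integrals over triangles and edges in barycentric coordinates -/

/-- The reference triangle with vertices `0`, `e₀`, `e₁`. -/
def refTriangle : Set Plane := {y | 0 ≤ y 0 ∧ 0 ≤ y 1 ∧ y 0 + y 1 ≤ 1}

/-- The affine map of the reference triangle onto the triangle with vertices `a`, `b`, `c`. -/
def triangleMap (a b c y : Plane) : Plane := a + y 0 • (b - a) + y 1 • (c - a)

/-- The determinant of two plane vectors. -/
def cross (u v : Plane) : ℝ := u 0 * v 1 - u 1 * v 0

theorem triangleMap_apply (a b c y : Plane) (i : Fin 2) :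
    triangleMap a b c y i = a i + y 0 * (b i - a i) + y 1 * (c i - a i) := by
  simp [triangleMap]

theorem continuous_triangleMap (a b c : Plane) : Continuous (triangleMap a b c) := by
  unfold triangleMap
  fun_prop

theorem isCompact_refTriangle : IsCompact refTriangle := by
  have hcl : IsClosed refTriangle := by
    have h0 : Continuous fun y : Plane => y 0 := by fun_prop
    have h1 : Continuous fun y : Plane => y 1 := by fun_prop
    exact (isClosed_le continuous_const h0).inter
      ((isClosed_le continuous_const h1).inter (isClosed_le (h0.add h1) continuous_const))
  refine Metric.isCompact_of_isClosed_isBounded hcl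
    (isBounded_iff_forall_norm_le.mpr ⟨2, fun y hy => ?_⟩)
  obtain ⟨h0, h1, h2⟩ := hy
  rw [EuclideanSpace.norm_eq, Fin.sum_univ_two]
  refine Real.sqrt_le_iff.mpr ⟨by norm_num, ?_⟩
  simp only [Real.norm_eq_abs, sq_abs]
  nlinarith

theorem measurableSet_refTriangle : MeasurableSet refTriangle :=
  isCompact_refTriangle.measurableSet

theorem hull_triple (a b c : Plane) :
    hull {a, b, c} = triangleMap a b c '' refTriangle := by
  apply Set.Subset.antisymm
  · refine convexHull_min ?_ ?_
    · intro x hx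
      simp only [Finset.coe_insert, Finset.coe_singleton, Set.mem_insert_iff,
        Set.mem_singleton_iff] at hx
      rcases hx with rfl | rfl | rfl
      · exact ⟨0, by simp [refTriangle], by simp [triangleMap]⟩
      · exact ⟨!₂[1, 0], by simp [refTriangle], by simp [triangleMap]⟩
      · exact ⟨!₂[0, 1], by simp [refTriangle], by simp [triangleMap]⟩
    · rintro _ ⟨y, ⟨h0, h1, h2⟩, rfl⟩ _ ⟨z, ⟨k0, k1, k2⟩, rfl⟩ s t hs ht hst
      refine ⟨s • y + t • z, ⟨?_, ?_, ?_⟩, ?_⟩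
      · simp only [PiLp.add_apply, PiLp.smul_apply, smul_eq_mul]; positivity
      · simp only [PiLp.add_apply, PiLp.smul_apply, smul_eq_mul]; positivity
      · simp only [PiLp.add_apply, PiLp.smul_apply, smul_eq_mul]; nlinarith
      · ext i
        simp only [PiLp.add_apply, PiLp.smul_apply, smul_eq_mul, triangleMap_apply]
        linear_combination (-(a i)) * hst
  · rintro _ ⟨y, ⟨h0, h1, h2⟩, rfl⟩
    have hsub := subset_convexHull ℝ ((({a, b, c} : Finset Plane) : Set Plane))
    have key := (convex_convexHull ℝ (({a, b, c} : Finset Plane) : Set Plane)).sum_mem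
      (t := Finset.univ) (w := ![1 - y 0 - y 1, y 0, y 1]) (z := ![a, b, c])
      (by intro i _; fin_cases i <;> simp <;> linarith)
      (by simp [Fin.sum_univ_three]; ring)
      (by intro i _; fin_cases i <;> exact hsub (by simp))
    have e : triangleMap a b c y =
        ∑ i, ![1 - y 0 - y 1, y 0, y 1] i • (![a, b, c] : Fin 3 → Plane) i := by
      ext i
      simp [Fin.sum_univ_three, triangleMap_apply]
      ring
    rw [e]
    exact key

theorem triangleMap_injective {a b c : Plane} (h : cross (b - a) (c - a) ≠ 0) :
    Function.Injective (triangleMap a b c) := by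
  intro y z hyz
  have e0 := congrArg (fun x : Plane => x 0) hyz
  have e1 := congrArg (fun x : Plane => x 1) hyz
  simp only [triangleMap_apply] at e0 e1
  simp only [cross, PiLp.sub_apply] at h
  have h0 : y 0 = z 0 := by
    refine mul_left_cancel₀ h ?_
    linear_combination (c 1 - a 1) * e0 - (c 0 - a 0) * e1
  have h1 : y 1 = z 1 := by
    refine mul_left_cancel₀ h ?_
    linear_combination (b 0 - a 0) * e1 - (b 1 - a 1) * e0
  ext i
  fin_cases i
  · exact h0
  · exact h1

theorem integral_hull_triple {a b c : Plane} (h : cross (b - a) (c - a) ≠ 0) (F : Plane → ℝ) :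
    ∫ x in hull {a, b, c}, F x =
      |cross (b - a) (c - a)| * ∫ y in refTriangle, F (triangleMap a b c y) := by
  let L : Plane →L[ℝ] Plane :=
    (EuclideanSpace.proj (0 : Fin 2) : Plane →L[ℝ] ℝ).smulRight (b - a) +
      (EuclideanSpace.proj (1 : Fin 2) : Plane →L[ℝ] ℝ).smulRight (c - a)
  have hL : triangleMap a b c = fun y => a + L y := by
    funext y
    simp [triangleMap, L, add_assoc]
  have hdet : L.det = cross (b - a) (c - a) := by
    rw [ContinuousLinearMap.det, ← LinearMap.det_toMatrix (EuclideanSpace.basisFun (Fin 2) ℝ).toBasis,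
      Matrix.det_fin_two]
    simp [LinearMap.toMatrix_apply, L, cross]
    ring
  have hder : ∀ y ∈ refTriangle, HasFDerivWithinAt (triangleMap a b c) L refTriangle y := by
    intro y _
    rw [hL]
    exact (L.hasFDerivAt.const_add a).hasFDerivWithinAt
  rw [hull_triple, integral_image_eq_integral_abs_det_fderiv_smul volume measurableSet_refTriangle
    hder (triangleMap_injective h).injOn]
  simp only [hdet, smul_eq_mul]
  exact integral_const_mul _ _

theorem integral_refTriangle {F : Plane → ℝ} (hF : Continuous F) :
    ∫ y in refTriangle, F y = ∫ t in (0 : ℝ)..1, ∫ s in (0 : ℝ)..(1 - t), F !₂[s, t] := by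
  let e : Plane ≃ᵐ ℝ × ℝ :=
    (MeasurableEquiv.toLp 2 (Fin 2 → ℝ)).symm.trans MeasurableEquiv.finTwoArrow
  have he : MeasurePreserving e :=
    (volume_preserving_finTwoArrow ℝ).comp
      (EuclideanSpace.volume_preserving_symm_measurableEquiv_toLp (Fin 2))
  have hsymm : ∀ p : ℝ × ℝ, e.symm p = !₂[p.1, p.2] := fun p => rfl
  have hi : Integrable (refTriangle.indicator F) :=
    (hF.continuousOn.integrableOn_compact isCompact_refTriangle).integrable_indicator
      measurableSet_refTriangle
  rw [← integral_indicator measurableSet_refTriangle,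
    ← he.symm.integral_comp e.symm.measurableEmbedding]
  have hi' : Integrable (fun p : ℝ × ℝ => refTriangle.indicator F (e.symm p)) :=
    (he.symm.integrable_comp_emb e.symm.measurableEmbedding).mpr hi
  rw [Measure.volume_eq_prod] at hi' ⊢
  rw [integral_prod_symm _ hi', intervalIntegral.integral_of_le zero_le_one,
    ← integral_Icc_eq_integral_Ioc, ← integral_indicator measurableSet_Icc]
  congr 1
  funext t
  by_cases ht : t ∈ Set.Icc (0 : ℝ) 1
  · rw [Set.indicator_of_mem ht, intervalIntegral.integral_of_le (by linarith [ht.2]),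
      ← integral_Icc_eq_integral_Ioc, ← integral_indicator measurableSet_Icc]
    congr 1
    funext s
    simp only [hsymm]
    by_cases hs : s ∈ Set.Icc (0 : ℝ) (1 - t)
    · rw [Set.indicator_of_mem hs, Set.indicator_of_mem]
      exact ⟨hs.1, ht.1, by simp; linarith [hs.2]⟩
    · rw [Set.indicator_of_notMem hs, Set.indicator_of_notMem]
      rintro ⟨h0, -, h2⟩
      simp at h0 h2
      exact hs ⟨h0, by linarith⟩
  · rw [Set.indicator_of_notMem ht]
    refine (integral_congr_ae (Filter.Eventually.of_forall fun s => ?_)).trans (integral_zero _ _)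
    simp only [hsymm]
    rw [Set.indicator_of_notMem]
    rintro ⟨h0, h1, h2⟩
    simp at h0 h1 h2
    exact ht ⟨h1, by linarith⟩

theorem hull_pair (x y : Plane) : hull {x, y} = AffineMap.lineMap x y '' Set.Icc (0 : ℝ) 1 := by
  simp [hull, segment_eq_image_lineMap]

theorem edgeIntegral_pair {x y : Plane} (hxy : x ≠ y) (F : Plane → ℝ) :
    edgeIntegral {x, y} F = dist x y * ∫ t in (0 : ℝ)..1, F (x + t • (y - x)) := by
  have hinj : Function.Injective (AffineMap.lineMap x y : ℝ → Plane) :=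
    AffineMap.lineMap_injective ℝ hxy
  have hemb : MeasurableEmbedding (AffineMap.lineMap x y : ℝ → Plane) :=
    AffineMap.lineMap_continuous.measurableEmbedding hinj
  have hmap : ((Measure.hausdorffMeasure 1 : Measure Plane).restrict
      (AffineMap.lineMap x y '' Set.Icc (0 : ℝ) 1)) =
      nndist x y • ((volume : Measure ℝ).restrict (Set.Icc 0 1)).map (AffineMap.lineMap x y) := by
    ext s hs
    rw [Measure.restrict_apply hs, Measure.smul_apply, hemb.map_apply,
      Measure.restrict_apply (hemb.measurable hs), ← hausdorffMeasure_real,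
      ← hausdorffMeasure_lineMap_image, Set.image_preimage_inter]
  rw [edgeIntegral, hull_pair, hmap, integral_smul_nnreal_measure, hemb.integral_map,
    intervalIntegral.integral_of_le zero_le_one, integral_Icc_eq_integral_Ioc]
  simp only [AffineMap.lineMap_apply, vsub_eq_sub, vadd_eq_add, add_comm _ x]
  rfl

/-! ### Normals and heights -/

theorem plane_inner (u v : Plane) : ⟪u, v⟫ = u 0 * v 0 + u 1 * v 1 := by
  simp [PiLp.inner_apply, Fin.sum_univ_two, mul_comm]

theorem plane_norm_sq (u : Plane) : ‖u‖ ^ 2 = u 0 ^ 2 + u 1 ^ 2 := by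
  rw [← real_inner_self_eq_norm_sq, plane_inner]
  ring

theorem abs_cross_eq_norm_mul_inner {u e n : Plane} (hn : ‖n‖ = 1) (hen : ⟪e, n⟫ = 0)
    (hu : 0 ≤ ⟪u, n⟫) : |cross u e| = ‖e‖ * ⟪u, n⟫ := by
  have hn2 : n 0 ^ 2 + n 1 ^ 2 = 1 := by rw [← plane_norm_sq, hn, one_pow]
  rw [← abs_of_nonneg (mul_nonneg (norm_nonneg e) hu), ← sq_eq_sq_iff_abs_eq_abs, mul_pow,
    plane_norm_sq]
  rw [plane_inner] at hen ⊢
  unfold cross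
  have h0 : e 0 = (n 0 * e 1 - n 1 * e 0) * (-n 1) := by
    linear_combination (-e 0) * hn2 + n 0 * hen
  have h1 : e 1 = (n 0 * e 1 - n 1 * e 0) * n 0 := by
    linear_combination (-e 1) * hn2 + n 1 * hen
  generalize n 0 * e 1 - n 1 * e 0 = m at h0 h1
  rw [h0, h1]
  linear_combination (-m ^ 2 * (u 0 * n 0 + u 1 * n 1) ^ 2) * hn2

theorem cross_sub_left (u v : Plane) : cross u (v - u) = cross u v := by
  simp [cross]; ring

theorem cross_sub_right (u v : Plane) : cross v (v - u) = cross u v := by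
  simp [cross]; ring

theorem erase_triple {a b c : Plane} (hab : a ≠ b) (hac : a ≠ c) :
    ({a, b, c} : Finset Plane).erase a = {b, c} := by
  rw [Finset.erase_insert]
  simp [hab, hac]

theorem outwardNormal_spec {a b c : Plane} (h : cross (b - a) (c - a) ≠ 0) :
    ⟪c - b, outwardNormal {a, b, c} a⟫ = 0 ∧
    ‖c - b‖ * ⟪b - a, outwardNormal {a, b, c} a⟫ = |cross (b - a) (c - a)| ∧
    ‖c - b‖ * ⟪c - a, outwardNormal {a, b, c} a⟫ = |cross (b - a) (c - a)| := by
  have hab : a ≠ b := by rintro rfl; simp [cross] at h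
  have hac : a ≠ c := by rintro rfl; simp [cross] at h
  have hbc : b ≠ c := by rintro rfl; simp [cross, mul_comm] at h
  set W := (vectorSpan ℝ (({b, c} : Finset Plane) : Set Plane))ᗮ with hW
  set z : Plane := (b - a) + (c - a) with hz
  set p := W.starProjection z with hp
  have hn : outwardNormal {a, b, c} a = NormedSpace.normalize p := by
    simp only [outwardNormal, erase_triple hab hac, Finset.sum_pair hbc]
    rfl
  have hpW : p ∈ W := Submodule.starProjection_apply_mem _ _
  have hspan : c - b ∈ vectorSpan ℝ (({b, c} : Finset Plane) : Set Plane) :=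
    vsub_mem_vectorSpan ℝ (by simp) (by simp)
  have hep : ⟪c - b, p⟫ = 0 := (Submodule.mem_orthogonal _ _).mp hpW _ hspan
  have hzp : ⟪z, p⟫ = ‖p‖ ^ 2 := by
    have : ⟪z - p, p⟫ = 0 := Submodule.starProjection_inner_eq_zero z p hpW
    rw [inner_sub_left, real_inner_self_eq_norm_sq] at this
    linarith
  have hp0 : p ≠ 0 := by
    intro h0
    have hmem : z ∈ Wᗮ := (Submodule.starProjection_apply_eq_zero_iff W).mp h0
    rw [hW, Submodule.orthogonal_orthogonal, Finset.coe_pair, vectorSpan_pair,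
      Submodule.mem_span_singleton] at hmem
    obtain ⟨r, hr⟩ := hmem
    have e0 := congrArg (fun x : Plane => x 0) hr
    have e1 := congrArg (fun x : Plane => x 1) hr
    simp [hz] at e0 e1
    apply h
    simp only [cross, PiLp.sub_apply]
    linear_combination ((c 0 - b 0) * e1 - (c 1 - b 1) * e0) / 2
  have hbp : ⟪b - a, p⟫ = ‖p‖ ^ 2 / 2 := by
    have e : b - a = (1 / 2 : ℝ) • (z - (c - b)) := by rw [hz]; module
    rw [e, real_inner_smul_left, inner_sub_left, hep, hzp]; ring
  have hcp : ⟪c - a, p⟫ = ‖p‖ ^ 2 / 2 := by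
    have e : c - a = (1 / 2 : ℝ) • (z + (c - b)) := by rw [hz]; module
    rw [e, real_inner_smul_left, inner_add_left, hep, hzp]; ring
  have hinner : ∀ x : Plane, ⟪x, NormedSpace.normalize p⟫ = ‖p‖⁻¹ * ⟪x, p⟫ := fun x => by
    rw [NormedSpace.normalize, real_inner_smul_right]
  have hnorm : ‖NormedSpace.normalize p‖ = 1 := NormedSpace.norm_normalize hp0
  have he : ⟪c - b, NormedSpace.normalize p⟫ = 0 := by rw [hinner, hep, mul_zero]
  have hcb : c - b = (c - a) - (b - a) := by abel
  rw [hn]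
  refine ⟨he, ?_, ?_⟩
  · rw [← abs_cross_eq_norm_mul_inner hnorm he (by rw [hinner, hbp]; positivity), hcb,
      cross_sub_left]
  · rw [← abs_cross_eq_norm_mul_inner hnorm he (by rw [hinner, hcp]; positivity), hcb,
      cross_sub_right]

/-- A disk inside a triangle has a diameter of at most the heights of the triangle. -/
theorem disk_le_cross {a b c x : Plane} {r : ℝ} (hr : 0 < r)
    (hball : Metric.closedBall x r ⊆ hull {a, b, c}) :
    2 * r * ‖c - b‖ ≤ |cross (b - a) (c - a)| := by
  rcases eq_or_ne (c - b) 0 with he | he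
  · simp [he]
  have hval : ∀ y ∈ hull {a, b, c}, ∃ l : ℝ, 0 ≤ l ∧ l ≤ 1 ∧
      cross (y - a) (c - b) = l * cross (b - a) (c - a) := by
    intro y hy
    rw [hull_triple] at hy
    obtain ⟨z, ⟨h0, h1, h2⟩, rfl⟩ := hy
    refine ⟨z 0 + z 1, by positivity, h2, ?_⟩
    simp only [cross, PiLp.sub_apply, triangleMap_apply]
    ring
  set n : Plane := (r / ‖c - b‖) • !₂[(c - b) 1, -(c - b) 0] with hn
  have hpos : 0 < ‖c - b‖ := norm_pos_iff.mpr he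
  have hnn : ‖n‖ = r := by
    have h1 : ‖(!₂[(c - b) 1, -(c - b) 0] : Plane)‖ = ‖c - b‖ := by
      rw [← sq_eq_sq₀ (norm_nonneg _) (norm_nonneg _), plane_norm_sq, plane_norm_sq]
      simp
      ring
    rw [hn, norm_smul, h1, Real.norm_of_nonneg (by positivity)]
    field_simp
  obtain ⟨l, hl0, hl1, hl⟩ := hval (x + n) (hball (by simp [hnn]))
  obtain ⟨m, hm0, hm1, hm⟩ := hval (x - n) (hball (by simp [hnn]))
  have hcr : cross n (c - b) = r * ‖c - b‖ := by
    have : cross n (c - b) = r / ‖c - b‖ * ‖c - b‖ ^ 2 := by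
      rw [plane_norm_sq, hn]
      simp [cross]
      ring
    rw [this]
    field_simp
  have hdiff : 2 * r * ‖c - b‖ = (l - m) * cross (b - a) (c - a) := by
    rw [sub_mul, ← hl, ← hm, mul_assoc, ← hcr]
    simp [cross]
    ring
  rw [hdiff]
  refine (le_abs_self _).trans ?_
  rw [abs_mul]
  exact mul_le_of_le_one_left (abs_nonneg _) (abs_le.mpr ⟨by linarith, by linarith⟩)

theorem norm_sub_le_diam {T : Finset Plane} {x y : Plane} (hx : x ∈ T) (hy : y ∈ T) :
    ‖x - y‖ ≤ diam T := by
  rw [← dist_eq_norm]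
  exact Metric.dist_le_diam_of_mem (isCompact_hull T).isBounded
    (subset_convexHull ℝ _ hx) (subset_convexHull ℝ _ hy)

/-! ### Bilinear forms on finite-dimensional spaces -/

theorem exists_form_le_norm_sq {V : Type*} [NormedAddCommGroup V] [NormedSpace ℝ V]
    [FiniteDimensional ℝ V] (B : V →ₗ[ℝ] V →ₗ[ℝ] ℝ) :
    ∃ C : ℝ, 0 < C ∧ ∀ x, B x x ≤ C * ‖x‖ ^ 2 := by
  let B' := B.toContinuousBilinearMap
  refine ⟨‖B'‖ + 1, by positivity, fun x => ?_⟩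
  calc B x x ≤ ‖B' x x‖ := Real.le_norm_self _
    _ ≤ ‖B'‖ * ‖x‖ * ‖x‖ := B'.le_opNorm₂ x x
    _ ≤ (‖B'‖ + 1) * ‖x‖ ^ 2 := by nlinarith [sq_nonneg ‖x‖]

/-- On a finite-dimensional space every bilinear form is bounded by every positive definite one. -/
theorem exists_form_bound {V : Type*} [AddCommGroup V] [Module ℝ V] [FiniteDimensional ℝ V]
    (A B : V →ₗ[ℝ] V →ₗ[ℝ] ℝ) (hsymm : ∀ x y, A x y = A y x) (hnonneg : ∀ x, 0 ≤ A x x)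
    (hdef : ∀ x, A x x = 0 → x = 0) :
    ∃ C : ℝ, 0 < C ∧ ∀ x, B x x ≤ C * A x x := by
  let core : InnerProductSpace.Core ℝ V :=
    { inner := fun x y => A x y
      conj_inner_symm := fun x y => by simpa using hsymm y x
      re_inner_nonneg := fun x => by simpa using hnonneg x
      add_left := fun x y z => by simp
      smul_left := fun x y r => by simp
      definite := hdef }
  let _ : NormedAddCommGroup V := core.toNormedAddCommGroup
  let _ : InnerProductSpace ℝ V := InnerProductSpace.ofCore core.toCore
  obtain ⟨C, hC, h⟩ := exists_form_le_norm_sq B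
  refine ⟨C, hC, fun x => (h x).trans_eq ?_⟩
  rw [← real_inner_self_eq_norm_sq x]
  rfl

/-- The weighted `L²` form over a compact set, pulled back along a linear map into the
continuous functions. -/
def weightedForm {V X : Type*} [AddCommGroup V] [Module ℝ V] [TopologicalSpace X]
    [T2Space X] [MeasurableSpace X] [BorelSpace X] (μ : Measure X) [IsFiniteMeasureOnCompacts μ]
    {K : Set X} (hK : IsCompact K) (w : C(X, ℝ)) (E : V →ₗ[ℝ] C(X, ℝ)) :
    V →ₗ[ℝ] V →ₗ[ℝ] ℝ :=
  have hint : ∀ f g : V, IntegrableOn (fun x => w x * (E f x * E g x)) K μ := fun f g =>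
    (w.continuous.mul ((E f).continuous.mul (E g).continuous)).continuousOn.integrableOn_compact hK
  LinearMap.mk₂ ℝ (fun f g => ∫ x in K, w x * (E f x * E g x) ∂μ)
    (fun f f' g => by
      simp only [map_add, ContinuousMap.add_apply, add_mul, mul_add]
      exact integral_add (hint f g) (hint f' g))
    (fun r f g => by
      simp only [map_smul, ContinuousMap.smul_apply, smul_eq_mul]
      rw [← integral_const_mul]
      congr with x; ring)
    (fun f g g' => by
      simp only [map_add, ContinuousMap.add_apply, mul_add]
      exact integral_add (hint f g) (hint f g'))
    (fun r f g => by
      simp only [map_smul, ContinuousMap.smul_apply, smul_eq_mul]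
      rw [← integral_const_mul]
      congr with x; ring)

theorem weightedForm_self {V X : Type*} [AddCommGroup V] [Module ℝ V] [TopologicalSpace X]
    [T2Space X] [MeasurableSpace X] [BorelSpace X] (μ : Measure X) [IsFiniteMeasureOnCompacts μ]
    {K : Set X} (hK : IsCompact K) (w : C(X, ℝ)) (E : V →ₗ[ℝ] C(X, ℝ)) (f : V) :
    weightedForm μ hK w E f f = ∫ x in K, w x * E f x ^ 2 ∂μ := by
  simp [weightedForm, sq]

/-- On a finite-dimensional space of functions determined by their values on an open subset `U`
of `K` where `w` is positive, every bilinear form is bounded by the `w`-weighted `L²(K)` norm. -/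
theorem exists_weighted_bound {V X : Type*} [AddCommGroup V] [Module ℝ V] [FiniteDimensional ℝ V]
    [TopologicalSpace X] [T2Space X] [MeasurableSpace X] [BorelSpace X] (μ : Measure X)
    [IsFiniteMeasureOnCompacts μ] [μ.IsOpenPosMeasure] {K U : Set X} (hK : IsCompact K)
    (w : C(X, ℝ)) (E : V →ₗ[ℝ] C(X, ℝ)) (hw : ∀ x ∈ K, 0 ≤ w x) (hU : IsOpen U) (hUK : U ⊆ K)
    (hwU : ∀ x ∈ U, 0 < w x) (hE : ∀ f, (∀ x ∈ U, E f x = 0) → f = 0)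
    (B : V →ₗ[ℝ] V →ₗ[ℝ] ℝ) :
    ∃ C : ℝ, 0 < C ∧ ∀ f, B f f ≤ C * ∫ x in K, w x * E f x ^ 2 ∂μ := by
  have hnn : ∀ f, 0 ≤ᵐ[μ.restrict K] fun x => w x * E f x ^ 2 := fun f =>
    (ae_restrict_iff' hK.measurableSet).mpr
      (ae_of_all _ fun x hx => mul_nonneg (hw x hx) (sq_nonneg _))
  have hcont : ∀ f, Continuous fun x => w x * E f x ^ 2 := fun f =>
    w.continuous.mul ((E f).continuous.pow 2)
  obtain ⟨C, hC, h⟩ := exists_form_bound (weightedForm μ hK w E) B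
    (fun f g => by simp [weightedForm, mul_comm])
    (fun f => by rw [weightedForm_self]; exact integral_nonneg_of_ae (hnn f))
    (fun f hf => by
      rw [weightedForm_self, setIntegral_eq_zero_iff_of_nonneg_ae (hnn f)
        ((hcont f).continuousOn.integrableOn_compact hK)] at hf
      have hae : (fun x => w x * E f x ^ 2) =ᵐ[μ.restrict U] fun _ => (0 : ℝ) :=
        ae_restrict_of_ae_restrict_of_subset hUK hf
      have heq := Measure.eqOn_open_of_ae_eq hae hU (hcont f).continuousOn continuousOn_const
      refine hE f fun x hx => ?_
      have := heq hx
      simpa [(hwU x hx).ne'] using this)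
  exact ⟨C, hC, fun f => by rw [← weightedForm_self μ hK]; exact h f⟩

/-- The Cauchy-Schwarz inequality for continuous functions on a compact set. -/
theorem sq_setIntegral_mul_le {X : Type*} [TopologicalSpace X] [T2Space X] [MeasurableSpace X]
    [BorelSpace X] (μ : Measure X) [IsFiniteMeasureOnCompacts μ] {K : Set X} (hK : IsCompact K)
    {f g : X → ℝ} (hf : Continuous f) (hg : Continuous g) :
    (∫ x in K, f x * g x ∂μ) ^ 2 ≤ (∫ x in K, f x ^ 2 ∂μ) * ∫ x in K, g x ^ 2 ∂μ := by
  have hint : ∀ {h : X → ℝ}, Continuous h → IntegrableOn h K μ := fun hh =>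
    hh.continuousOn.integrableOn_compact hK
  have key : ∀ t : ℝ, 0 ≤ (∫ x in K, g x ^ 2 ∂μ) * (t * t) +
      (2 * ∫ x in K, f x * g x ∂μ) * t + ∫ x in K, f x ^ 2 ∂μ := by
    intro t
    have h0 : 0 ≤ ∫ x in K, (t * g x + f x) ^ 2 ∂μ := integral_nonneg fun x => sq_nonneg _
    have h1 : ∫ x in K, (t * g x + f x) ^ 2 ∂μ =
        ∫ x in K, ((t * t) * g x ^ 2 + (2 * t) * (f x * g x) + f x ^ 2) ∂μ := by
      congr with x; ring
    have i1 : IntegrableOn (fun x => (t * t) * g x ^ 2) K μ := hint (by fun_prop)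
    have i2 : IntegrableOn (fun x => (2 * t) * (f x * g x)) K μ := hint (by fun_prop)
    have i12 : IntegrableOn (fun x => (t * t) * g x ^ 2 + (2 * t) * (f x * g x)) K μ :=
      hint (by fun_prop)
    have i3 : IntegrableOn (fun x => f x ^ 2) K μ := hint (by fun_prop)
    rw [h1, integral_add i12 i3, integral_add i1 i2, integral_const_mul,
      integral_const_mul] at h0
    linarith
  have := discrim_le_zero key
  rw [discrim] at this
  linarith

/-! ### Polynomials -/

theorem polyEval_add (p q : MvPolynomial (Fin 2) ℝ) (x : Plane) :
    polyEval (p + q) x = polyEval p x + polyEval q x := map_add _ _ _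

theorem polyEval_sub (p q : MvPolynomial (Fin 2) ℝ) (x : Plane) :
    polyEval (p - q) x = polyEval p x - polyEval q x := map_sub _ _ _

theorem polyEval_mul (p q : MvPolynomial (Fin 2) ℝ) (x : Plane) :
    polyEval (p * q) x = polyEval p x * polyEval q x := map_mul _ _ _

theorem polyEval_pow (p : MvPolynomial (Fin 2) ℝ) (n : ℕ) (x : Plane) :
    polyEval (p ^ n) x = polyEval p x ^ n := map_pow _ _ _

theorem polyEval_sum {ι : Type*} (s : Finset ι) (p : ι → MvPolynomial (Fin 2) ℝ) (x : Plane) :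
    polyEval (∑ i ∈ s, p i) x = ∑ i ∈ s, polyEval (p i) x := map_sum _ _ _

theorem polyEval_C (r : ℝ) (x : Plane) : polyEval (MvPolynomial.C r) x = r :=
  MvPolynomial.eval_C _

theorem polyEval_X (i : Fin 2) (x : Plane) : polyEval (MvPolynomial.X i) x = x i :=
  MvPolynomial.eval_X _

theorem continuous_polyEval_line (p : MvPolynomial (Fin 2) ℝ) (x u : Plane) :
    Continuous fun t : ℝ => polyEval p (x + t • u) :=
  (continuous_polyEval p).comp (by fun_prop)

/-- The derivative of a polynomial in the direction `u`. -/
def dirDeriv (u : Plane) (p : MvPolynomial (Fin 2) ℝ) : MvPolynomial (Fin 2) ℝ :=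
  MvPolynomial.C (u 0) * MvPolynomial.pderiv 0 p + MvPolynomial.C (u 1) * MvPolynomial.pderiv 1 p

theorem dirDeriv_mul (u : Plane) (p q : MvPolynomial (Fin 2) ℝ) :
    dirDeriv u (p * q) = dirDeriv u p * q + p * dirDeriv u q := by
  simp only [dirDeriv, MvPolynomial.pderiv_mul]
  ring

theorem hasDerivAt_polyEval (p : MvPolynomial (Fin 2) ℝ) (x u : Plane) (s : ℝ) :
    HasDerivAt (fun s : ℝ => polyEval p (x + s • u)) (polyEval (dirDeriv u p) (x + s • u)) s := by
  induction p using MvPolynomial.induction_on with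
  | C r => simpa [polyEval_C, dirDeriv, polyEval] using hasDerivAt_const s r
  | add p q hp hq =>
    have e : dirDeriv u (p + q) = dirDeriv u p + dirDeriv u q := by
      simp only [dirDeriv, map_add]; ring
    simp only [e, polyEval_add]
    exact hp.add hq
  | mul_X p i hp =>
    have e : dirDeriv u (MvPolynomial.X i) = MvPolynomial.C (u i) := by
      fin_cases i <;> simp [dirDeriv, MvPolynomial.pderiv_X]
    have h : HasDerivAt (fun s : ℝ => x i + s * u i) (u i) s := by
      simpa using ((hasDerivAt_id s).mul_const (u i)).const_add (x i)
    simp only [dirDeriv_mul, e, polyEval_add, polyEval_mul, polyEval_X, polyEval_C,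
      PiLp.add_apply, PiLp.smul_apply, smul_eq_mul]
    exact hp.mul h

theorem totalDegree_pderiv_le {p : MvPolynomial (Fin 2) ℝ} {m : ℕ} (hp : p.totalDegree ≤ m + 1)
    (i : Fin 2) : (MvPolynomial.pderiv i p).totalDegree ≤ m := by
  conv_lhs => rw [p.as_sum, map_sum]
  refine MvPolynomial.totalDegree_finsetSum_le fun d hd => ?_
  rw [MvPolynomial.pderiv_monomial]
  rcases Nat.eq_zero_or_pos (d i) with h0 | hpos
  · simp [h0]
  · refine (MvPolynomial.totalDegree_monomial_le _ _).trans ?_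
    have h1 : d.degree ≤ m + 1 := (MvPolynomial.le_totalDegree hd).trans hp
    have h2 : d = (d - Finsupp.single i 1) + Finsupp.single i 1 := by
      rw [tsub_add_cancel_of_le]
      simpa using Nat.one_le_iff_ne_zero.mpr hpos.ne'
    have h3 := congrArg Finsupp.degree h2
    rw [map_add, Finsupp.degree_single] at h3
    change (d - Finsupp.single i 1).degree ≤ m
    omega

theorem totalDegree_C_mul_le (r : ℝ) (p : MvPolynomial (Fin 2) ℝ) :
    (MvPolynomial.C r * p).totalDegree ≤ p.totalDegree := by
  refine (MvPolynomial.totalDegree_mul _ _).trans ?_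
  simp

theorem totalDegree_dirDeriv_le {p : MvPolynomial (Fin 2) ℝ} {m : ℕ} (hp : p.totalDegree ≤ m + 1)
    (u : Plane) : (dirDeriv u p).totalDegree ≤ m :=
  (MvPolynomial.totalDegree_add _ _).trans (max_le
    ((totalDegree_C_mul_le _ _).trans (totalDegree_pderiv_le hp 0))
    ((totalDegree_C_mul_le _ _).trans (totalDegree_pderiv_le hp 1)))

/-- A polynomial of degree at most one. -/
def affinePoly (r u v : ℝ) : MvPolynomial (Fin 2) ℝ :=
  MvPolynomial.C r + MvPolynomial.C u * MvPolynomial.X 0 + MvPolynomial.C v * MvPolynomial.X 1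

theorem polyEval_affinePoly (r u v : ℝ) (x : Plane) :
    polyEval (affinePoly r u v) x = r + u * x 0 + v * x 1 := by
  simp [affinePoly, polyEval]

theorem totalDegree_affinePoly_le (r u v : ℝ) : (affinePoly r u v).totalDegree ≤ 1 := by
  refine (MvPolynomial.totalDegree_add _ _).trans (max_le ((MvPolynomial.totalDegree_add _ _).trans
    (max_le (by simp) ((totalDegree_C_mul_le _ _).trans (by simp))))
    ((totalDegree_C_mul_le _ _).trans (by simp)))

/-- Polynomials of degree at most `m` stay such under affine substitutions. -/
theorem exists_pullback {p : MvPolynomial (Fin 2) ℝ} {m : ℕ} (hp : p.totalDegree ≤ m)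
    (a b c : Plane) : ∃ q : MvPolynomial (Fin 2) ℝ, q.totalDegree ≤ m ∧
      ∀ y, polyEval q y = polyEval p (triangleMap a b c y) := by
  let l : Fin 2 → MvPolynomial (Fin 2) ℝ := fun i => affinePoly (a i) (b i - a i) (c i - a i)
  refine ⟨MvPolynomial.bind₁ l p, ?_, fun y => ?_⟩
  · conv_lhs => rw [p.as_sum, map_sum]
    refine MvPolynomial.totalDegree_finsetSum_le fun d hd => ?_
    rw [MvPolynomial.bind₁_monomial]
    refine (totalDegree_C_mul_le _ _).trans ((MvPolynomial.totalDegree_finsetProd _ _).trans ?_)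
    refine le_trans (Finset.sum_le_sum fun i _ => ?_) ((MvPolynomial.le_totalDegree hd).trans hp)
    calc (l i ^ d i).totalDegree ≤ d i * (l i).totalDegree := MvPolynomial.totalDegree_pow _ _
      _ ≤ d i * 1 := Nat.mul_le_mul_left _ (totalDegree_affinePoly_le _ _ _)
      _ = d i := mul_one _
  · unfold polyEval
    rw [MvPolynomial.eval, MvPolynomial.eval₂Hom_bind₁]
    congr 2
    funext i
    have := polyEval_affinePoly (a i) (b i - a i) (c i - a i) y
    rw [polyEval, MvPolynomial.eval] at this
    rw [this, triangleMap_apply]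
    ring

/-- On a line, a polynomial of degree at most `m` is one in the line parameter. -/
theorem exists_line_coeff {p : MvPolynomial (Fin 2) ℝ} {m : ℕ} (hp : p.totalDegree ≤ m)
    (x u : Plane) : ∃ c : ℕ → ℝ, ∀ t : ℝ,
      polyEval p (x + t • u) = ∑ i ∈ Finset.range (m + 1), c i * t ^ i := by
  let l : Fin 2 → Polynomial ℝ := fun i => Polynomial.C (x i) + Polynomial.C (u i) * Polynomial.X
  have hl : ∀ i, (l i).natDegree ≤ 1 := fun i => by
    refine Polynomial.natDegree_add_le_of_degree_le (by simp) ?_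
    exact (Polynomial.natDegree_C_mul_le _ _).trans Polynomial.natDegree_X_le
  have hdeg := MvPolynomial.aeval_natDegree_le p hp l hl
  refine ⟨(MvPolynomial.aeval l p).coeff, fun t => ?_⟩
  rw [← Polynomial.eval_eq_sum_range' (by omega)]
  have h : MvPolynomial.eval (fun i => (x + t • u) i) =
      (Polynomial.evalRingHom t).comp (MvPolynomial.aeval l).toRingHom := by
    apply MvPolynomial.ringHom_ext
    · intro r
      simp
    · intro i
      simp [l, mul_comm (u i) t]
  exact RingHom.congr_fun h p

/-! ### Test fields in a constant direction -/

/-- The vector field `G u` with `G` a polynomial and `u` a vector. -/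
def constDirField {m : ℕ} {G : MvPolynomial (Fin 2) ℝ} (hG : G.totalDegree ≤ m) (u : Plane) :
    PolyField m := fun i =>
  ⟨MvPolynomial.C (u i) * G, (MvPolynomial.mem_restrictTotalDegree _ _ _).mpr
    ((totalDegree_C_mul_le _ _).trans hG)⟩

theorem constDirField_val {m : ℕ} {G : MvPolynomial (Fin 2) ℝ} (hG : G.totalDegree ≤ m)
    (u x : Plane) : (constDirField hG u).val x = polyEval G x • u := by
  ext i
  fin_cases i <;> simp [PolyField.val, constDirField, polyEval, mul_comm]

theorem constDirField_div {m : ℕ} {G : MvPolynomial (Fin 2) ℝ} (hG : G.totalDegree ≤ m)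
    (u x : Plane) : (constDirField hG u).div x = polyEval (dirDeriv u G) x := by
  simp [PolyField.div, constDirField, dirDeriv]

/-- The divergence theorem on a triangle for a field with the direction of an edge. -/
theorem integral_dirDeriv {a b c : Plane} (h : cross (b - a) (c - a) ≠ 0)
    (F : MvPolynomial (Fin 2) ℝ) :
    ∫ x in hull {a, b, c}, polyEval (dirDeriv (b - a) F) x =
      |cross (b - a) (c - a)| * ((∫ t in (0 : ℝ)..1, polyEval F (b + t • (c - b))) -
        ∫ t in (0 : ℝ)..1, polyEval F (a + t • (c - a))) := by
  rw [integral_hull_triple h, integral_refTriangle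
    (F := fun y => polyEval (dirDeriv (b - a) F) (triangleMap a b c y))
    ((continuous_polyEval _).comp (continuous_triangleMap a b c)),
    ← intervalIntegral.integral_sub
      ((continuous_polyEval_line F _ _).intervalIntegrable _ _)
      ((continuous_polyEval_line F _ _).intervalIntegrable _ _)]
  congr 1
  refine intervalIntegral.integral_congr fun t _ => ?_
  have e : ∀ s : ℝ, triangleMap a b c !₂[s, t] = (a + t • (c - a)) + s • (b - a) := fun s => by
    simp [triangleMap]; abel
  simp only [e]
  rw [intervalIntegral.integral_eq_sub_of_hasDerivAt
    (fun s _ => hasDerivAt_polyEval F (a + t • (c - a)) (b - a) s)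
    ((continuous_polyEval_line _ _ _).intervalIntegrable _ _)]
  congr 2
  · module
  · module

/-! ### Inverse estimates on the reference triangle and on the unit interval -/

/-- Polynomials of degree at most `m`, as continuous functions. -/
def polyEvalLinear (m : ℕ) : MvPolynomial.restrictTotalDegree (Fin 2) ℝ m →ₗ[ℝ] C(Plane, ℝ) where
  toFun p := ⟨polyEval p, continuous_polyEval _⟩
  map_add' p q := by ext x; simp [polyEval]
  map_smul' r p := by ext x; simp [polyEval]

theorem exists_bubble_bound (m : ℕ) : ∃ C : ℝ, 0 < C ∧
    ∀ p : MvPolynomial (Fin 2) ℝ, p.totalDegree ≤ m →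
      ∫ y in refTriangle, polyEval p y ^ 2 ≤
        C * ∫ y in refTriangle, (1 - y 0 - y 1) * y 0 * polyEval p y ^ 2 := by
  let w : C(Plane, ℝ) := ⟨fun y => (1 - y 0 - y 1) * y 0, by fun_prop⟩
  let U : Set Plane := {y | 0 < y 0 ∧ 0 < y 1 ∧ y 0 + y 1 < 1}
  have h0 : Continuous fun y : Plane => y 0 := by fun_prop
  have h1 : Continuous fun y : Plane => y 1 := by fun_prop
  have hU : IsOpen U := (isOpen_lt continuous_const h0).inter
    ((isOpen_lt continuous_const h1).inter (isOpen_lt (h0.add h1) continuous_const))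
  obtain ⟨C, hC, h⟩ := exists_weighted_bound volume isCompact_refTriangle w (polyEvalLinear m)
    (fun y hy => mul_nonneg (by linarith [hy.2.2]) hy.1) hU
    (fun y hy => ⟨hy.1.le, hy.2.1.le, hy.2.2.le⟩)
    (fun y hy => mul_pos (by linarith [hy.2.2]) hy.1)
    (fun p hp => Subtype.ext (polyEval_eq_zero hU
      ⟨!₂[1 / 3, 1 / 3], by simp, by simp, by simp; norm_num⟩ hp))
    (weightedForm volume isCompact_refTriangle 1 (polyEvalLinear m))
  refine ⟨C, hC, fun p hp => ?_⟩
  have := h ⟨p, (MvPolynomial.mem_restrictTotalDegree _ _ _).mpr hp⟩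
  rw [weightedForm_self] at this
  simpa [polyEvalLinear, w] using this

/-- The function `t ↦ ∑ cᵢ tⁱ`, as a linear function of the coefficients. -/
def coeffEvalLinear (n : ℕ) : (Fin n → ℝ) →ₗ[ℝ] C(ℝ, ℝ) where
  toFun c := ⟨fun t => ∑ i, c i * t ^ (i : ℕ), by fun_prop⟩
  map_add' c d := by ext t; simp [add_mul, Finset.sum_add_distrib]
  map_smul' r c := by ext t; simp [Finset.mul_sum, mul_assoc]

theorem coeffEvalLinear_eq_zero {n : ℕ} {c : Fin n → ℝ}
    (h : ∀ t ∈ Set.Ioo (0 : ℝ) 1, coeffEvalLinear n c t = 0) : c = 0 := by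
  let p : Polynomial ℝ := ∑ i : Fin n, Polynomial.monomial (i : ℕ) (c i)
  have hp : p = 0 := by
    refine Polynomial.eq_zero_of_infinite_isRoot p
      ((Set.Ioo_infinite zero_lt_one).mono fun t ht => ?_)
    have := h t ht
    simp only [coeffEvalLinear, LinearMap.coe_mk, AddHom.coe_mk, ContinuousMap.coe_mk] at this
    simpa [Polynomial.IsRoot, p, Polynomial.eval_finsetSum] using this
  funext i
  have := congrArg (fun q => Polynomial.coeff q (i : ℕ)) hp
  simpa [p, Polynomial.finsetSum_coeff, Polynomial.coeff_monomial, Fin.val_inj] using this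

theorem exists_coeff_bound (n : ℕ) : ∃ C : ℝ, 0 < C ∧ ∀ c : ℕ → ℝ,
    (∑ i ∈ Finset.range n, |c i|) ^ 2 ≤
      C * ∫ t in (0 : ℝ)..1, (∑ i ∈ Finset.range n, c i * t ^ i) ^ 2 := by
  obtain ⟨C, hC, h⟩ := exists_weighted_bound (volume : Measure ℝ) (isCompact_Icc (a := 0) (b := 1))
    1 (coeffEvalLinear n) (fun _ _ => zero_le_one) isOpen_Ioo Set.Ioo_subset_Icc_self
    (fun _ _ => zero_lt_one) (fun c hc => coeffEvalLinear_eq_zero hc) (dotProductBilin ℝ ℝ)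
  refine ⟨(n + 1) * C, by positivity, fun c => ?_⟩
  have h1 := h fun i => c i
  simp only [coeffEvalLinear, LinearMap.coe_mk, AddHom.coe_mk, ContinuousMap.coe_mk,
    ContinuousMap.one_apply, one_mul, integral_Icc_eq_integral_Ioc,
    ← intervalIntegral.integral_of_le (zero_le_one' ℝ)] at h1
  have h0 : ∀ t : ℝ, ∑ i : Fin n, c i * t ^ (i : ℕ) = ∑ i ∈ Finset.range n, c i * t ^ i :=
    fun t => Fin.sum_univ_eq_sum_range (fun i => c i * t ^ i) n
  simp only [h0] at h1
  have h2 : (∑ i ∈ Finset.range n, |c i|) ^ 2 ≤ n * ∑ i ∈ Finset.range n, c i ^ 2 := by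
    have := sq_sum_le_card_mul_sum_sq (s := Finset.range n) (f := fun i => |c i|)
    simpa using this
  have h3 : dotProductBilin ℝ ℝ (fun i : Fin n => c i) (fun i : Fin n => c i) =
      ∑ i ∈ Finset.range n, c i ^ 2 := by
    simp [dotProduct, ← sq, Fin.sum_univ_eq_sum_range (fun i => c i ^ 2)]
  rw [h3] at h1
  have h4 : 0 ≤ ∑ i ∈ Finset.range n, c i ^ 2 := Finset.sum_nonneg fun i _ => sq_nonneg _
  calc _ ≤ n * ∑ i ∈ Finset.range n, c i ^ 2 := h2
    _ ≤ (n + 1) * ∑ i ∈ Finset.range n, c i ^ 2 := by linarith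
    _ ≤ (n + 1) * (C * _) := by gcongr
    _ = _ := by ring

/-! ### Barycentric coordinates as polynomials -/

/-- The barycentric coordinate of the vertex `b` of the triangle `a b c`. -/
def baryPoly (a b c : Plane) : MvPolynomial (Fin 2) ℝ :=
  affinePoly ((a 1 * (c 0 - a 0) - a 0 * (c 1 - a 1)) / cross (b - a) (c - a))
    ((c 1 - a 1) / cross (b - a) (c - a)) (-(c 0 - a 0) / cross (b - a) (c - a))

theorem totalDegree_baryPoly_le (a b c : Plane) : (baryPoly a b c).totalDegree ≤ 1 :=
  totalDegree_affinePoly_le _ _ _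

theorem polyEval_baryPoly {a b c : Plane} (h : cross (b - a) (c - a) ≠ 0) (y : Plane) :
    polyEval (baryPoly a b c) (triangleMap a b c y) = y 0 := by
  rw [baryPoly, polyEval_affinePoly, triangleMap_apply, triangleMap_apply]
  field_simp
  simp only [cross, PiLp.sub_apply]
  ring

theorem triangleMap_swap (a b c y : Plane) :
    triangleMap a b c y = triangleMap a c b !₂[y 1, y 0] := by
  simp [triangleMap]
  abel

theorem cross_swap (u v : Plane) : cross u v = -cross v u := by
  simp [cross]; ring

theorem polyEval_baryPoly_swap {a b c : Plane} (h : cross (b - a) (c - a) ≠ 0) (y : Plane) :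
    polyEval (baryPoly a c b) (triangleMap a b c y) = y 1 := by
  rw [triangleMap_swap, polyEval_baryPoly (by rwa [cross_swap, neg_ne_zero])]
  simp

theorem edge_bc_eq (a b c : Plane) (t : ℝ) :
    b + t • (c - b) = triangleMap a b c !₂[1 - t, t] := by
  simp only [triangleMap, Matrix.cons_val_zero, Matrix.cons_val_one]
  module

theorem edge_ac_eq (a b c : Plane) (t : ℝ) :
    a + t • (c - a) = triangleMap a b c !₂[0, t] := by
  simp [triangleMap]

/-! ### The weak gradient tested with fields of constant direction -/

theorem inner_smul_field {m : ℕ} (g : PolyField m) (r : ℝ) (x u : Plane) :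
    ⟪g.val x, r • u⟫ = ⟪g.val x, u⟫ * r := by
  rw [real_inner_smul_right, mul_comm]

theorem weakGradient_test {T : Finset Plane} {a b c : Plane} (hT : T = {a, b, c})
    (h : cross (b - a) (c - a) ≠ 0) {m : ℕ} {g : PolyField m} {P : MvPolynomial (Fin 2) ℝ}
    {W : Finset Plane → MvPolynomial (Fin 2) ℝ}
    (hg : IsWeakGradient T (polyEval P) (fun e => polyEval (W e)) g)
    {G : MvPolynomial (Fin 2) ℝ} (hG : G.totalDegree ≤ m) :
    ∫ x in hull T, ⟪g.val x, b - a⟫ * polyEval G x =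
      (∫ x in hull T, polyEval (dirDeriv (b - a) P) x * polyEval G x) +
        |cross (b - a) (c - a)| *
          ((∫ t in (0 : ℝ)..1, polyEval ((W {b, c} - P) * G) (b + t • (c - b))) -
            ∫ t in (0 : ℝ)..1, polyEval ((W {a, c} - P) * G) (a + t • (c - a))) := by
  have hab : a ≠ b := by rintro rfl; simp [cross] at h
  have hac : a ≠ c := by rintro rfl; simp [cross] at h
  have hbc : b ≠ c := by rintro rfl; simp [cross, mul_comm] at h
  have hcont : ∀ p : MvPolynomial (Fin 2) ℝ, IntegrableOn (polyEval p) (hull T) volume := fun p =>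
    (continuous_polyEval p).continuousOn.integrableOn_compact (isCompact_hull T)
  have e1 := hg (constDirField hG (b - a))
  simp only [constDirField_val, constDirField_div, inner_smul_field] at e1
  have e2 := integral_dirDeriv h (P * G)
  rw [← hT, dirDeriv_mul] at e2
  simp only [polyEval_add] at e2
  rw [integral_add (hcont _) (hcont _)] at e2
  have hTb : T = {b, a, c} := by rw [hT, Finset.insert_comm]
  have hTc : T = {c, a, b} := by
    rw [hTb, Finset.insert_comm, Finset.pair_comm b c, Finset.insert_comm]
  have hsum : ∀ F : Plane → ℝ, ∑ x ∈ T, F x = F a + F b + F c := fun F => by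
    rw [hT, Finset.sum_insert (by simp [hab, hac]), Finset.sum_pair hbc, add_assoc]
  have ha : T.erase a = {b, c} := by rw [hT, erase_triple hab hac]
  have hb : T.erase b = {a, c} := by rw [hTb, erase_triple hab.symm hbc]
  have hbx : cross (a - b) (c - b) = -cross (b - a) (c - a) := by
    simp [cross]; ring
  have hcx : cross (a - c) (b - c) = cross (b - a) (c - a) := by
    simp [cross]; ring
  have na : ‖c - b‖ * ⟪b - a, outwardNormal T a⟫ = |cross (b - a) (c - a)| := by
    rw [hT]; exact (outwardNormal_spec h).2.1
  have nb : ‖c - a‖ * ⟪b - a, outwardNormal T b⟫ = -|cross (b - a) (c - a)| := by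
    have := (outwardNormal_spec (a := b) (b := a) (c := c) (by rwa [hbx, neg_ne_zero])).2.1
    rw [← hTb, hbx, abs_neg, ← neg_sub b a, inner_neg_left] at this
    linarith
  have nc : ⟪b - a, outwardNormal T c⟫ = 0 := by
    have := (outwardNormal_spec (a := c) (b := a) (c := b) (by rwa [hcx])).1
    rwa [← hTc] at this
  have edge : ∀ (x y n : Plane) (p : MvPolynomial (Fin 2) ℝ), x ≠ y →
      edgeIntegral {x, y} (fun z => polyEval p z * ⟪polyEval G z • (b - a), n⟫) =
        (‖y - x‖ * ⟪b - a, n⟫) * ∫ t in (0 : ℝ)..1, polyEval (p * G) (x + t • (y - x)) := by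
    intro x y n p hxy
    rw [edgeIntegral_pair hxy, dist_comm, dist_eq_norm, mul_assoc,
      ← intervalIntegral.integral_const_mul ⟪b - a, n⟫]
    simp only [inner_smul_left, polyEval_mul, conj_trivial]
    congr 2
    funext t
    ring
  have e3 : edgeIntegral (T.erase c)
      (fun x => polyEval (W (T.erase c)) x * ⟪polyEval G x • (b - a), outwardNormal T c⟫) = 0 := by
    simp only [edgeIntegral, inner_smul_left, nc, mul_zero, integral_zero]
  rw [hsum, e3, ha, hb, edge b c _ _ hbc, edge a c _ _ hac, na, nb] at e1
  have hsub : ∀ (p : MvPolynomial (Fin 2) ℝ) (x u : Plane),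
      ∫ t in (0 : ℝ)..1, polyEval ((p - P) * G) (x + t • u) =
        (∫ t in (0 : ℝ)..1, polyEval (p * G) (x + t • u)) -
          ∫ t in (0 : ℝ)..1, polyEval (P * G) (x + t • u) := by
    intro p x u
    rw [← intervalIntegral.integral_sub
      ((continuous_polyEval_line _ _ _).intervalIntegrable _ _)
      ((continuous_polyEval_line _ _ _).intervalIntegrable _ _)]
    simp only [sub_mul, polyEval_sub]
  rw [hsub, hsub, e1]
  simp only [polyEval_mul] at e2 ⊢
  linear_combination -e2

theorem integral_inner_sq_le {m : ℕ} (T : Finset Plane) (g : PolyField m) (u : Plane) {d : ℝ}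
    (hu : ‖u‖ ≤ d) :
    ∫ x in hull T, ⟪g.val x, u⟫ ^ 2 ≤ d ^ 2 * ∫ x in hull T, ‖g.val x‖ ^ 2 := by
  rw [← integral_const_mul]
  have hg := g.continuous_val
  refine integral_mono
    (((hg.inner continuous_const).pow 2).continuousOn.integrableOn_compact (isCompact_hull T))
    (((hg.norm.pow 2).const_mul _).continuousOn.integrableOn_compact (isCompact_hull T))
    fun x => ?_
  have h1 : |⟪g.val x, u⟫| ≤ d * ‖g.val x‖ :=
    (abs_real_inner_le_norm _ _).trans (by rw [mul_comm]; gcongr)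
  calc ⟪g.val x, u⟫ ^ 2 = |⟪g.val x, u⟫| ^ 2 := (sq_abs _).symm
    _ ≤ (d * ‖g.val x‖) ^ 2 := by gcongr
    _ = d ^ 2 * ‖g.val x‖ ^ 2 := by ring

/-! ### Local estimates -/

theorem totalDegree_bubble_le {m : ℕ} {S : MvPolynomial (Fin 2) ℝ} (hS : S.totalDegree ≤ m)
    (a b c : Plane) :
    ((1 - baryPoly a b c - baryPoly a c b) * baryPoly a b c * S).totalDegree ≤ m + 2 := by
  have h0 : (1 - baryPoly a b c - baryPoly a c b).totalDegree ≤ 1 :=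
    (MvPolynomial.totalDegree_sub _ _).trans (max_le
      ((MvPolynomial.totalDegree_sub _ _).trans (max_le (by simp) (totalDegree_baryPoly_le _ _ _)))
      (totalDegree_baryPoly_le _ _ _))
  have h1 := totalDegree_baryPoly_le a b c
  have h2 := MvPolynomial.totalDegree_mul (1 - baryPoly a b c - baryPoly a c b) (baryPoly a b c)
  have h3 := MvPolynomial.totalDegree_mul
    ((1 - baryPoly a b c - baryPoly a c b) * baryPoly a b c) S
  omega

theorem polyEval_bubble {a b c : Plane} (h : cross (b - a) (c - a) ≠ 0)
    (S : MvPolynomial (Fin 2) ℝ) (y : Plane) :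
    polyEval ((1 - baryPoly a b c - baryPoly a c b) * baryPoly a b c * S) (triangleMap a b c y) =
      (1 - y 0 - y 1) * y 0 * polyEval S (triangleMap a b c y) := by
  have h1 : polyEval 1 (triangleMap a b c y) = 1 := map_one _
  simp only [polyEval_mul, polyEval_sub, polyEval_baryPoly h, polyEval_baryPoly_swap h, h1]

/-- The directional derivatives of the interior part along the edges are controlled by the
weak gradient. -/
theorem exists_dirDeriv_bound (m : ℕ) : ∃ C : ℝ, 0 < C ∧
    ∀ (T : Finset Plane) (a b c : Plane), T = {a, b, c} → cross (b - a) (c - a) ≠ 0 →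
    ∀ (g : PolyField (m + 2)) (P : MvPolynomial (Fin 2) ℝ)
      (W : Finset Plane → MvPolynomial (Fin 2) ℝ), P.totalDegree ≤ m + 1 →
      IsWeakGradient T (polyEval P) (fun e => polyEval (W e)) g →
      ∫ x in hull T, polyEval (dirDeriv (b - a) P) x ^ 2 ≤
        C * diam T ^ 2 * ∫ x in hull T, ‖g.val x‖ ^ 2 := by
  obtain ⟨C, hC, hbub⟩ := exists_bubble_bound m
  refine ⟨C ^ 2, by positivity, fun T a b c hT h g P W hP hg => ?_⟩
  set S := dirDeriv (b - a) P with hS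
  have hSdeg : S.totalDegree ≤ m := totalDegree_dirDeriv_le hP _
  set G := (1 - baryPoly a b c - baryPoly a c b) * baryPoly a b c * S with hG
  have hcont := continuous_polyEval
  have hGdeg : G.totalDegree ≤ m + 2 := totalDegree_bubble_le hSdeg a b c
  have hGval : ∀ y, polyEval G (triangleMap a b c y) =
    (1 - y 0 - y 1) * y 0 * polyEval S (triangleMap a b c y) := polyEval_bubble h S
  have key := weakGradient_test hT h hg hGdeg
  have z1 : ∀ (p : MvPolynomial (Fin 2) ℝ) (t : ℝ),
      polyEval (p * G) (b + t • (c - b)) = 0 := fun p t => by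
    rw [polyEval_mul, edge_bc_eq a, hGval]; simp
  have z2 : ∀ (p : MvPolynomial (Fin 2) ℝ) (t : ℝ),
      polyEval (p * G) (a + t • (c - a)) = 0 := fun p t => by
    rw [polyEval_mul, edge_ac_eq a b, hGval]; simp
  simp only [z1, z2, intervalIntegral.integral_zero, sub_zero, mul_zero, add_zero] at key
  have hab : ‖b - a‖ ≤ diam T := norm_sub_le_diam (by simp [hT]) (by simp [hT])
  have cs := sq_setIntegral_mul_le volume (isCompact_hull T)
    (g.continuous_val.inner (continuous_const (y := b - a))) (hcont G)
  have hN := integral_inner_sq_le T g (b - a) hab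
  set N := ∫ x in hull T, ‖g.val x‖ ^ 2
  have hN0 : 0 ≤ N := integral_nonneg fun x => sq_nonneg _
  set I := ∫ x in hull T, polyEval S x ^ 2
  have hI0 : 0 ≤ I := integral_nonneg fun x => sq_nonneg _
  have hGI : ∫ x in hull T, polyEval G x ^ 2 ≤ I := by
    refine setIntegral_mono_on
      (((hcont G).pow 2).continuousOn.integrableOn_compact (isCompact_hull T))
      (((hcont S).pow 2).continuousOn.integrableOn_compact (isCompact_hull T))
      (isCompact_hull T).measurableSet fun x hx => ?_
    rw [hT, hull_triple] at hx
    obtain ⟨y, ⟨h0, h1, h2⟩, rfl⟩ := hx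
    rw [hGval, mul_pow]
    refine mul_le_of_le_one_left (sq_nonneg _) (pow_le_one₀ ?_ ?_)
    · exact mul_nonneg (by linarith) h0
    · exact mul_le_one₀ (by linarith) h0 (by linarith)
  have hIJ : I ≤ C * ∫ x in hull T, ⟪g.val x, b - a⟫ * polyEval G x := by
    obtain ⟨q, hq, hqe⟩ := exists_pullback hSdeg a b c
    have := hbub q hq
    simp only [hqe] at this
    rw [key]
    simp only [I, hT]
    rw [integral_hull_triple h, integral_hull_triple h, mul_left_comm C]
    refine mul_le_mul_of_nonneg_left (this.trans_eq ?_) (abs_nonneg _)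
    congr 2
    funext y
    rw [hGval]
    ring
  rcases hI0.eq_or_lt with h0 | hpos
  · rw [← h0]; positivity
  · have h1 : I ^ 2 ≤ C ^ 2 * (diam T ^ 2 * N * I) := by
      calc I ^ 2 ≤ (C * ∫ x in hull T, ⟪g.val x, b - a⟫ * polyEval G x) ^ 2 := by gcongr
        _ = C ^ 2 * (∫ x in hull T, ⟪g.val x, b - a⟫ * polyEval G x) ^ 2 := by ring
        _ ≤ C ^ 2 * ((∫ x in hull T, ⟪g.val x, b - a⟫ ^ 2) * ∫ x in hull T, polyEval G x ^ 2) := by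
          gcongr
        _ ≤ C ^ 2 * (diam T ^ 2 * N * I) := by gcongr
    refine le_of_mul_le_mul_right ?_ hpos
    calc I * I = I ^ 2 := (sq I).symm
      _ ≤ _ := h1
      _ = _ := by ring

/-- The polynomial `∑ i < n, cᵢ lⁱ` in a polynomial `l`. -/
def sumPow (n : ℕ) (c : ℕ → ℝ) (l : MvPolynomial (Fin 2) ℝ) : MvPolynomial (Fin 2) ℝ :=
  ∑ i ∈ Finset.range n, MvPolynomial.C (c i) * l ^ i

theorem polyEval_sumPow (n : ℕ) (c : ℕ → ℝ) (l : MvPolynomial (Fin 2) ℝ) (x : Plane) :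
    polyEval (sumPow n c l) x = ∑ i ∈ Finset.range n, c i * polyEval l x ^ i := by
  simp only [sumPow, polyEval_sum, polyEval_mul, polyEval_C, polyEval_pow]

theorem totalDegree_sumPow_le {n : ℕ} (c : ℕ → ℝ) {l : MvPolynomial (Fin 2) ℝ}
    (hl : l.totalDegree ≤ 1) : (sumPow (n + 1) c l).totalDegree ≤ n := by
  refine MvPolynomial.totalDegree_finsetSum_le fun i hi => ?_
  refine (totalDegree_C_mul_le _ _).trans ((MvPolynomial.totalDegree_pow _ _).trans ?_)
  have : i ≤ n := by simpa [Nat.lt_succ_iff] using hi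
  calc i * l.totalDegree ≤ i * 1 := Nat.mul_le_mul_left _ hl
    _ ≤ n := by omega

theorem integral_refTriangle_const (r : ℝ) : ∫ _ in refTriangle, r = r / 2 := by
  rw [integral_refTriangle (F := fun _ => r) continuous_const]
  simp only [intervalIntegral.integral_const, sub_zero, smul_eq_mul]
  rw [intervalIntegral.integral_mul_const, intervalIntegral.integral_sub
    intervalIntegrable_const intervalIntegral.intervalIntegrable_id]
  simp
  ring

theorem integral_hull_sq_le {a b c : Plane} (h : cross (b - a) (c - a) ≠ 0)
    (G : MvPolynomial (Fin 2) ℝ) {M : ℝ}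
    (hG : ∀ y ∈ refTriangle, |polyEval G (triangleMap a b c y)| ≤ M) :
    ∫ x in hull {a, b, c}, polyEval G x ^ 2 ≤ |cross (b - a) (c - a)| * M ^ 2 := by
  rw [integral_hull_triple h]
  refine mul_le_mul_of_nonneg_left ?_ (abs_nonneg _)
  have h1 : ∫ y in refTriangle, polyEval G (triangleMap a b c y) ^ 2 ≤
      ∫ _ in refTriangle, M ^ 2 := by
    refine setIntegral_mono_on
      ((((continuous_polyEval G).comp
        (continuous_triangleMap a b c)).pow 2).continuousOn.integrableOn_compact
          isCompact_refTriangle)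
      (continuous_const.continuousOn.integrableOn_compact isCompact_refTriangle)
      measurableSet_refTriangle fun y hy => ?_
    rw [← sq_abs]
    exact pow_le_pow_left₀ (abs_nonneg _) (hG y hy) 2
  rw [integral_refTriangle_const] at h1
  nlinarith [sq_nonneg M]

theorem integral_edge_symm (F : Plane → ℝ) (b c : Plane) :
    ∫ t in (0 : ℝ)..1, F (c + t • (b - c)) = ∫ t in (0 : ℝ)..1, F (b + t • (c - b)) := by
  have := intervalIntegral.integral_comp_sub_left (fun t : ℝ => F (b + t • (c - b))) (1 : ℝ)
    (a := 0) (b := 1)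
  simp only [sub_zero, sub_self] at this
  rw [← this]
  congr 1
  funext t
  congr 1
  module

/-- On an edge, in the line parameter, the jump is controlled by the weak gradient. -/
theorem exists_jump_bound (m : ℕ) : ∃ C : ℝ, 0 < C ∧
    ∀ (T : Finset Plane) (a b c : Plane), T = {a, b, c} → cross (b - a) (c - a) ≠ 0 →
    ∀ (g : PolyField (m + 2)) (P : MvPolynomial (Fin 2) ℝ)
      (W : Finset Plane → MvPolynomial (Fin 2) ℝ), P.totalDegree ≤ m + 1 →
      (W {b, c}).totalDegree ≤ m + 2 →
      IsWeakGradient T (polyEval P) (fun e => polyEval (W e)) g →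
      |cross (b - a) (c - a)| * (∫ t in (0 : ℝ)..1, polyEval (W {b, c} - P) (b + t • (c - b)) ^ 2) ≤
        C * diam T ^ 2 * ∫ x in hull T, ‖g.val x‖ ^ 2 := by
  obtain ⟨C₁, hC₁, hder⟩ := exists_dirDeriv_bound m
  obtain ⟨C₂, hC₂, hcoef⟩ := exists_coeff_bound (m + 3)
  refine ⟨16 * (1 + C₁) * C₂, by positivity, fun T a b c hT h g P W hP hW hg => ?_⟩
  have hT' : T = {a, c, b} := by rw [hT, Finset.pair_comm b c]
  have h' : cross (c - a) (b - a) ≠ 0 := by rwa [cross_swap, neg_ne_zero]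
  have habs : |cross (c - a) (b - a)| = |cross (b - a) (c - a)| := by rw [cross_swap, abs_neg]
  set D := |cross (b - a) (c - a)| with hD
  have hwdeg : (W {b, c} - P).totalDegree ≤ m + 2 :=
    (MvPolynomial.totalDegree_sub _ _).trans (max_le hW (by omega))
  obtain ⟨κ, hκ⟩ := exists_line_coeff hwdeg b (c - b)
  set M := ∑ i ∈ Finset.range (m + 3), |κ i|
  have hM := hcoef κ
  simp only [← hκ] at hM
  set F := ∫ t in (0 : ℝ)..1, polyEval (W {b, c} - P) (b + t • (c - b)) ^ 2
  -- the test field `G₁ (c - a) + G₂ (b - a)`, whose normal component on the edge is the jump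
  let d : ℕ → ℝ := fun i => κ (i + 1) + if i = 0 then κ 0 else 0
  let G₁ := baryPoly a c b * sumPow (m + 2) d (baryPoly a c b)
  let G₂ := MvPolynomial.C (κ 0) * baryPoly a b c
  have hd : ∀ t : ℝ, t * ∑ i ∈ Finset.range (m + 2), d i * t ^ i + κ 0 * (1 - t) =
      ∑ i ∈ Finset.range (m + 3), κ i * t ^ i := by
    intro t
    rw [Finset.sum_range_succ' _ (m + 2)]
    simp only [d, add_mul, Finset.sum_add_distrib, ite_mul, zero_mul, Finset.sum_ite_eq',
      Finset.mem_range, mul_add, Finset.mul_sum, pow_succ]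
    simp
    ring_nf
  have hG₁ : ∀ y, polyEval G₁ (triangleMap a b c y) =
      y 1 * ∑ i ∈ Finset.range (m + 2), d i * y 1 ^ i := fun y => by
    simp only [G₁, polyEval_mul, polyEval_sumPow, polyEval_baryPoly_swap h]
  have hG₂ : ∀ y, polyEval G₂ (triangleMap a b c y) = κ 0 * y 0 := fun y => by
    simp only [G₂, polyEval_mul, polyEval_C, polyEval_baryPoly h]
  have hκ0 : |κ 0| ≤ M :=
    Finset.single_le_sum (f := fun i => |κ i|) (fun i _ => abs_nonneg _) (by simp)
  have hdeg₁ : G₁.totalDegree ≤ m + 2 := by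
    have h1 := MvPolynomial.totalDegree_mul (baryPoly a c b) (sumPow (m + 2) d (baryPoly a c b))
    have h2 := totalDegree_baryPoly_le a c b
    have h3 : (sumPow (m + 2) d (baryPoly a c b)).totalDegree ≤ m + 1 :=
      totalDegree_sumPow_le d h2
    simp only [G₁]
    omega
  have hdeg₂ : G₂.totalDegree ≤ m + 2 :=
    ((totalDegree_C_mul_le _ _).trans (totalDegree_baryPoly_le _ _ _)).trans (by omega)
  have hsup₁ : ∀ y ∈ refTriangle, |polyEval G₁ (triangleMap a b c y)| ≤ M := by
    rintro y ⟨h0, h1, h2⟩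
    have hy1 : y 1 ≤ 1 := by linarith
    have e : polyEval G₁ (triangleMap a b c y) =
        ∑ i ∈ Finset.range (m + 2), κ (i + 1) * y 1 ^ (i + 1) + κ 0 * y 1 := by
      have := hd (y 1)
      rw [Finset.sum_range_succ' _ (m + 2)] at this
      rw [hG₁]
      simp at this
      linarith
    have hM' : M = ∑ i ∈ Finset.range (m + 2), |κ (i + 1)| + |κ 0| := Finset.sum_range_succ' _ _
    rw [e, hM']
    refine (abs_add_le _ _).trans (add_le_add ((Finset.abs_sum_le_sum_abs _ _).trans
      (Finset.sum_le_sum fun i _ => ?_)) ?_)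
    · rw [abs_mul, abs_of_nonneg (pow_nonneg h1 _)]
      exact mul_le_of_le_one_right (abs_nonneg _) (pow_le_one₀ h1 hy1)
    · rw [abs_mul, abs_of_nonneg h1]
      exact mul_le_of_le_one_right (abs_nonneg _) hy1
  have hsup₂ : ∀ y ∈ refTriangle, |polyEval G₂ (triangleMap a b c y)| ≤ M := by
    rintro y ⟨h0, h1, h2⟩
    rw [hG₂, abs_mul, abs_of_nonneg h0]
    exact (mul_le_of_le_one_right (abs_nonneg _) (by linarith)).trans hκ0
  have t1 := weakGradient_test hT' h' hg hdeg₁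
  have t2 := weakGradient_test hT h hg hdeg₂
  have z1 : ∀ (p : MvPolynomial (Fin 2) ℝ) (t : ℝ),
      polyEval (p * G₁) (a + t • (b - a)) = 0 := fun p t => by
    have e : a + t • (b - a) = triangleMap a b c !₂[t, 0] := by simp [triangleMap]
    rw [polyEval_mul, e, hG₁]; simp
  have z2 : ∀ (p : MvPolynomial (Fin 2) ℝ) (t : ℝ),
      polyEval (p * G₂) (a + t • (c - a)) = 0 := fun p t => by
    rw [polyEval_mul, edge_ac_eq a b, hG₂]; simp
  rw [habs, integral_edge_symm, Finset.pair_comm c b] at t1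
  rw [← hD] at t2
  simp only [z1, z2, intervalIntegral.integral_zero, sub_zero] at t1 t2
  have hF : (∫ t in (0 : ℝ)..1, polyEval ((W {b, c} - P) * G₁) (b + t • (c - b))) +
      (∫ t in (0 : ℝ)..1, polyEval ((W {b, c} - P) * G₂) (b + t • (c - b))) = F := by
    rw [← intervalIntegral.integral_add
      ((continuous_polyEval_line _ _ _).intervalIntegrable _ _)
      ((continuous_polyEval_line _ _ _).intervalIntegrable _ _)]
    refine intervalIntegral.integral_congr fun t _ => ?_
    have e : polyEval G₁ (b + t • (c - b)) + polyEval G₂ (b + t • (c - b)) =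
        polyEval (W {b, c} - P) (b + t • (c - b)) := by
      rw [hκ, ← hd t, edge_bc_eq a, hG₁, hG₂]
      simp
    simp only [polyEval_mul, ← mul_add, e, sq]
  have hcont := continuous_polyEval
  have hgc : ∀ u : Plane, Continuous fun x => ⟪g.val x, u⟫ := fun u =>
    g.continuous_val.inner continuous_const
  have hba : ‖b - a‖ ≤ diam T := norm_sub_le_diam (by simp [hT]) (by simp [hT])
  have hca : ‖c - a‖ ≤ diam T := norm_sub_le_diam (by simp [hT]) (by simp [hT])
  have i1 := integral_inner_sq_le T g (c - a) hca
  have i2 := integral_inner_sq_le T g (b - a) hba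
  have i3 := hder T a c b hT' h' g P W hP hg
  have i4 := hder T a b c hT h g P W hP hg
  have q1 := integral_hull_sq_le h G₁ hsup₁
  have q2 := integral_hull_sq_le h G₂ hsup₂
  rw [← hT, ← hD] at q1 q2
  have c1 := sq_setIntegral_mul_le volume (isCompact_hull T) (hgc (c - a)) (hcont G₁)
  have c2 := sq_setIntegral_mul_le volume (isCompact_hull T) (hgc (b - a)) (hcont G₂)
  have c3 := sq_setIntegral_mul_le volume (isCompact_hull T)
    (hcont (dirDeriv (c - a) P)) (hcont G₁)
  have c4 := sq_setIntegral_mul_le volume (isCompact_hull T)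
    (hcont (dirDeriv (b - a) P)) (hcont G₂)
  set N := ∫ x in hull T, ‖g.val x‖ ^ 2
  have hN0 : 0 ≤ N := integral_nonneg fun x => sq_nonneg _
  have hF0 : 0 ≤ F := intervalIntegral.integral_nonneg zero_le_one fun t _ => sq_nonneg _
  have hD0 : 0 ≤ D := abs_nonneg _
  have hdN : 0 ≤ diam T ^ 2 * N := by positivity
  have hCdN : 0 ≤ C₁ * (diam T ^ 2 * N) := by positivity
  have bound : ∀ {J X Y : ℝ}, J ^ 2 ≤ X * Y → X ≤ (1 + C₁) * (diam T ^ 2 * N) → 0 ≤ Y →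
      Y ≤ D * M ^ 2 → J ^ 2 ≤ (1 + C₁) * C₂ * (diam T ^ 2 * N) * (D * F) := by
    intro J X Y h1 h2 h3 h4
    calc J ^ 2 ≤ X * Y := h1
      _ ≤ (1 + C₁) * (diam T ^ 2 * N) * Y := by gcongr
      _ ≤ (1 + C₁) * (diam T ^ 2 * N) * (D * (C₂ * F)) := by
        gcongr
        exact h4.trans (by gcongr)
      _ = _ := by ring
  have b1 := bound c1 (by linarith) (integral_nonneg fun x => sq_nonneg _) q1
  have b2 := bound c2 (by linarith) (integral_nonneg fun x => sq_nonneg _) q2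
  have b3 := bound c3 (by linarith) (integral_nonneg fun x => sq_nonneg _) q1
  have b4 := bound c4 (by linarith) (integral_nonneg fun x => sq_nonneg _) q2
  clear_value F N M D
  generalize (∫ x in hull T, ⟪g.val x, c - a⟫ * polyEval G₁ x) = J₁ at t1 b1
  generalize (∫ x in hull T, ⟪g.val x, b - a⟫ * polyEval G₂ x) = J₂ at t2 b2
  generalize (∫ x in hull T, polyEval (dirDeriv (c - a) P) x * polyEval G₁ x) = J₃ at t1 b3
  generalize (∫ x in hull T, polyEval (dirDeriv (b - a) P) x * polyEval G₂ x) = J₄ at t2 b4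
  have hDF : D * F = J₁ + J₂ - J₃ - J₄ := by rw [t1, t2, ← hF]; ring
  have hDF0 : 0 ≤ D * F := mul_nonneg hD0 hF0
  have hsq : (D * F) ^ 2 ≤ 4 * (J₁ ^ 2 + J₂ ^ 2 + J₃ ^ 2 + J₄ ^ 2) := by
    rw [hDF]
    linarith [sq_nonneg (J₁ - J₂), sq_nonneg (J₁ + J₃), sq_nonneg (J₁ + J₄),
      sq_nonneg (J₂ + J₃), sq_nonneg (J₂ + J₄), sq_nonneg (J₃ - J₄)]
  rcases hDF0.eq_or_lt with h0 | hpos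
  · rw [← h0]; positivity
  · refine le_of_mul_le_mul_right ?_ hpos
    calc D * F * (D * F) = (D * F) ^ 2 := (sq _).symm
      _ ≤ 4 * (J₁ ^ 2 + J₂ ^ 2 + J₃ ^ 2 + J₄ ^ 2) := hsq
      _ ≤ 16 * ((1 + C₁) * C₂ * (diam T ^ 2 * N) * (D * F)) := by linarith
      _ = _ := by ring

/-- The jump over one edge of a shape-regular triangle. -/
theorem edge_jump_le {T : Finset Plane} {a b c : Plane} (hT : T = {a, b, c}) (hbc : b ≠ c)
    {x : Plane} {r σ C N : ℝ} (hr : 0 < r) (hball : Metric.closedBall x r ⊆ hull T)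
    (hσ : diam T ≤ σ * (2 * r)) (hCN : 0 ≤ C * N) {p : MvPolynomial (Fin 2) ℝ}
    (hp : |cross (b - a) (c - a)| * (∫ t in (0 : ℝ)..1, polyEval p (b + t • (c - b)) ^ 2) ≤
      C * diam T ^ 2 * N) :
    (diam T)⁻¹ * edgeIntegral {b, c} (fun y => polyEval p y ^ 2) ≤ C * σ * N := by
  have hd : 0 < diam T := (norm_pos_iff.mpr (sub_ne_zero.mpr hbc.symm)).trans_le
    (norm_sub_le_diam (by simp [hT]) (by simp [hT]))
  rw [hT] at hball
  have hdisk := disk_le_cross hr hball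
  rw [edgeIntegral_pair hbc, dist_comm, dist_eq_norm]
  set F := ∫ t in (0 : ℝ)..1, polyEval p (b + t • (c - b)) ^ 2
  have hF0 : 0 ≤ F := intervalIntegral.integral_nonneg zero_le_one fun t _ => sq_nonneg _
  have h1 : 2 * r * (‖c - b‖ * F) ≤ 2 * r * (C * σ * N * diam T) := by
    calc 2 * r * (‖c - b‖ * F) = 2 * r * ‖c - b‖ * F := by ring
      _ ≤ |cross (b - a) (c - a)| * F := by gcongr
      _ ≤ C * diam T ^ 2 * N := hp
      _ = C * N * diam T * diam T := by ring
      _ ≤ C * N * diam T * (σ * (2 * r)) := by gcongr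
      _ = _ := by ring
  have h2 := le_of_mul_le_mul_left h1 (by positivity)
  rw [inv_mul_le_iff₀ hd]
  linarith

end WG

end

theorem lemma3p1 (k : ℕ) (hk : 1 ≤ k) (σ : ℝ) (hσ : 0 < σ) :
    ∃ C : ℝ, 0 < C ∧
      ∀ (Ω : Set WG.Plane), IsOpen Ω → IsConnected Ω →
        ∀ K : WG.Mesh Ω, K.ShapeRegular σ →
          ∀ v : WG.WeakFunction K k,
            ∑ T ∈ K.triangles, (WG.diam T)⁻¹ * v.jumpSq T ≤ C * v.tripleNormSq := by
  open WG in
  obtain ⟨m, rfl⟩ : ∃ m, k = m + 1 := ⟨k - 1, by omega⟩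
  obtain ⟨C, hC, hjump⟩ := exists_jump_bound m
  refine ⟨3 * (C * σ), by positivity, fun Ω _ _ K hK v => ?_⟩
  rw [WeakFunction.tripleNormSq, Finset.mul_sum]
  refine Finset.sum_le_sum fun T hT => ?_
  have hcard := (Mesh.mem_triangles.mp hT).2
  obtain ⟨x, r, hr, hball, hdiam⟩ := hK T hT
  obtain ⟨P, hPdeg, hP⟩ := v.v0_poly T hT
  have hWex : ∀ e : Finset Plane, ∃ p : MvPolynomial (Fin 2) ℝ, e ∈ K.edges →
      p.totalDegree ≤ m + 2 ∧ ∀ x ∈ hull e, v.vb e x = polyEval p x := fun e => by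
    by_cases he : e ∈ K.edges
    · obtain ⟨p, hp⟩ := v.vb_poly e he
      exact ⟨p, fun _ => hp⟩
    · exact ⟨0, fun h => absurd h he⟩
  choose W hW using hWex
  have hmeas : ∀ s : Finset Plane, MeasurableSet (hull s) := fun s =>
    (isCompact_hull s).measurableSet
  have hg : IsWeakGradient T (polyEval P) (fun e => polyEval (W e)) (v.weakGradient T) := by
    intro q
    rw [v.isWeakGradient_weakGradient hT q]
    congr 1
    · congr 1
      exact setIntegral_congr_fun (hmeas T) fun y hy => by simp only [hP y hy]
    · refine Finset.sum_congr rfl fun a ha => setIntegral_congr_fun (hmeas _) fun y hy => ?_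
      simp only [(hW _ (Mesh.erase_mem_edges hT ha)).2 y hy]
  set N := ∫ x in hull T, ‖(v.weakGradient T).val x‖ ^ 2
  have hN0 : 0 ≤ N := integral_nonneg fun x => sq_nonneg _
  have hedge : ∀ a ∈ T, (diam T)⁻¹ * edgeIntegral (T.erase a)
      (fun x => (v.v0 T x - v.vb (T.erase a) x) ^ 2) ≤ C * σ * N := by
    intro a ha
    have he := Mesh.erase_mem_edges hT ha
    obtain ⟨b, c, hbc, hbce⟩ := Finset.card_eq_two.mp
      (show (T.erase a).card = 2 by rw [Finset.card_erase_of_mem ha, hcard])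
    have hTabc : T = {a, b, c} := by rw [← hbce, Finset.insert_erase ha]
    have hcross : cross (b - a) (c - a) ≠ 0 := by
      rw [hTabc] at hball
      have h1 := disk_le_cross hr hball
      have h2 : 0 < ‖c - b‖ := norm_pos_iff.mpr (sub_ne_zero.mpr hbc.symm)
      exact abs_pos.mp (lt_of_lt_of_le (by positivity) h1)
    have hWdeg := (hW _ he).1
    have hWval := (hW _ he).2
    have hTsub : hull (T.erase a) ⊆ hull T :=
      convexHull_mono (Finset.coe_subset.mpr (Finset.erase_subset _ _))
    have e1 : edgeIntegral (T.erase a) (fun x => (v.v0 T x - v.vb (T.erase a) x) ^ 2) =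
        edgeIntegral (T.erase a) (fun x => polyEval (W (T.erase a) - P) x ^ 2) := by
      refine setIntegral_congr_fun (hmeas _) fun y hy => ?_
      simp only [hWval y hy, hP y (hTsub hy), polyEval_sub]
      ring
    rw [e1]
    rw [hbce] at hWdeg ⊢
    exact edge_jump_le hTabc hbc hr hball hdiam (by positivity)
      (hjump T a b c hTabc hcross _ P W hPdeg hWdeg hg)
  rw [WeakFunction.jumpSq, Finset.mul_sum]
  calc _ ≤ ∑ a ∈ T, C * σ * N := Finset.sum_le_sum hedge
    _ = 3 * (C * σ) * N := by rw [Finset.sum_const, hcard, nsmul_eq_mul]; push_cast; ring
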